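/- Let $\mathbb K=\mathbb R$ or $\mathbb C$, let $X$ be a compact topological space, $n\in\mathbb N$, $1\le p\le\infty$ and $I=[0,1]$. Write $\Theta(\mathbb K^m)=X\times\mathbb K^m$ for the product bundle over $X$. Let $\mathcal V\subset\Theta(\mathbb K^{2n})$ be an $n$-dimensional subbundle with fibres $\mathcal V_x\subset\mathbb K^{2n}=\mathbb K^n\times\mathbb K^n$. For $x\in X$ put $$L_{B_x}u=u',\qquad \mathcal D(L_{B_x})=\{u\in W^{1,p}(I,\mathbb K^n):(u(0),u(1))\in\mathcal V_x\},$$ where $u(0),u(1)$ are the boundary values of the continuous representative of $u$. Then the following are equivalent: (i) There is a map $K:X\to\mathcal L(W^{1,p}(I,\mathbb K^n),L^p(I,\mathbb K^n))$, continuous for the operator norm, such that every $K_x$ is a compact operator and, for every $x\in X$, the operator $L_{B_x}+K_x:\mathcal D(L_{B_x})\to L^p(I,\mathbb K^n)$ is invertible (that is, it is a bijection with bounded inverse, where $\mathcal D(L_{B_x})$ carries the norm of $W^{1,p}(I,\mathbb K^n)$). (ii) $\mathcal V$ is stably trivial, that is, $\mathcal V\oplus\Theta(\mathbb K^m)\cong\Theta(\mathbb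 K^N)$ for some $m,N\in\mathbb N$. -/

import Mathlib

open MeasureTheory Set

noncomputable section

namespace IndexBundle

section Bundles

variable {𝕜 X : Type*} [RCLike 𝕜] [TopologicalSpace X]
variable {E F : Type*} [NormedAddCommGroup E] [NormedSpace 𝕜 E]
  [NormedAddCommGroup F] [NormedSpace 𝕜 F]

/-- The total space `{(x, v) : v ∈ V x}` of a family of subspaces of `E`, with the topology
induced from `X × E`. -/
abbrev Total (V : X → Submodule 𝕜 E) : Type _ := {q : X × E // q.2 ∈ V q.1}

/-- The product bundle `Θ(E)` over `X`. -/
def Theta (𝕜 X E : Type*) [RCLike 𝕜] [NormedAddCommGroup E] [NormedSpace 𝕜 E] :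
    X → Submodule 𝕜 E := fun _ => ⊤

/-- The fibrewise direct sum `V ⊕ W`. -/
def dirSum (V : X → Submodule 𝕜 E) (W : X → Submodule 𝕜 F) : X → Submodule 𝕜 (E × F) :=
  fun x => (V x).prod (W x)

/-- `V ≅ W` over `X`: there is a homeomorphism of the total spaces over the identity of `X`
which is linear on the fibres. -/
def BundleIso (V : X → Submodule 𝕜 E) (W : X → Submodule 𝕜 F) : Prop :=
  ∃ φ : ∀ x, V x ≃ₗ[𝕜] W x,
    Continuous (fun q : Total V => (φ q.1.1 ⟨q.1.2, q.2⟩ : F)) ∧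
    Continuous (fun q : Total W => ((φ q.1.1).symm ⟨q.1.2, q.2⟩ : E))

/-- `V` is an `n`-dimensional subbundle of the product bundle `Θ(E)`: it is locally isomorphic
to the product bundle with fibre `𝕜ⁿ`. -/
def IsSubbundle (n : ℕ) (V : X → Submodule 𝕜 E) : Prop :=
  ∀ x : X, ∃ U : Set X, IsOpen U ∧ x ∈ U ∧
    BundleIso (fun y : U => V y) (Theta 𝕜 U (EuclideanSpace 𝕜 (Fin n)))

/-- `V` is stably trivial: `V ⊕ Θ(𝕜ᵐ) ≅ Θ(𝕜ᴺ)` for some `m` and `N`. -/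
def StablyTrivial (V : X → Submodule 𝕜 E) : Prop :=
  ∃ m N : ℕ, BundleIso (dirSum V (Theta 𝕜 X (EuclideanSpace 𝕜 (Fin m))))
    (Theta 𝕜 X (EuclideanSpace 𝕜 (Fin N)))

end Bundles

section Sobolev

open scoped ENNReal

/-- Lebesgue measure on `I = [0, 1]`. -/
abbrev muI : Measure ℝ := volume.restrict (Icc (0 : ℝ) 1)

/-- The space `L^p(I, 𝕜ⁿ)`. -/
abbrev LpI (𝕜 : Type*) [RCLike 𝕜] (n : ℕ) (p : ℝ≥0∞) :=
  Lp (EuclideanSpace 𝕜 (Fin n)) p muI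

variable (𝕜 : Type*) [RCLike 𝕜] (n : ℕ) (p : ℝ≥0∞)

/-- `g` is the weak derivative of `u` on the open interval `(0, 1)`. -/
def IsWeakDeriv {𝕜 : Type*} [RCLike 𝕜] {n : ℕ} (u g : ℝ → EuclideanSpace 𝕜 (Fin n)) : Prop :=
  ∀ φ : ℝ → ℝ, ContDiff ℝ (⊤ : ℕ∞) φ → HasCompactSupport φ → tsupport φ ⊆ Ioo 0 1 →
    ∫ t, deriv φ t • u t ∂muI = -∫ t, φ t • g t ∂muI

variable {𝕜 n p}

theorem integrable_test_smul [Fact (1 ≤ p)] (u : LpI 𝕜 n p) {ψ : ℝ → ℝ}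
    (hψ : Continuous ψ) (hc : HasCompactSupport ψ) :
    Integrable (fun t => ψ t • u t) muI := by
  obtain ⟨C, hC⟩ := hψ.bounded_above_of_compact_support hc
  exact ((Lp.memLp u).integrable Fact.out).bdd_smul C hψ.aestronglyMeasurable
    (Filter.Eventually.of_forall hC)

variable (𝕜 n p)

/-- The Sobolev space `W^{1,p}(I, 𝕜ⁿ)`, whose elements `u` are represented by the pairs
`(u, u')` of `u ∈ L^p` and its (unique) weak derivative `u' ∈ L^p`. The norm is the usual
one: `(‖u‖^p + ‖u'‖^p)^(1/p)`, and `max ‖u‖ ‖u'‖` for `p = ∞`. -/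
def W1p [Fact (1 ≤ p)] : Submodule 𝕜 (WithLp p (LpI 𝕜 n p × LpI 𝕜 n p)) where
  carrier := {w | IsWeakDeriv (w.fst : ℝ → EuclideanSpace 𝕜 (Fin n)) w.snd}
  zero_mem' := by
    intro φ _ _ _
    have h : ((0 : LpI 𝕜 n p) : ℝ → EuclideanSpace 𝕜 (Fin n)) =ᵐ[muI] 0 := Lp.coeFn_zero _ _ _
    have h1 : ∫ t, deriv φ t • (0 : LpI 𝕜 n p) t ∂muI = 0 := by
      refine integral_eq_zero_of_ae ?_
      filter_upwards [h] with t ht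
      rw [ht, Pi.zero_apply, smul_zero]
    have h2 : ∫ t, φ t • (0 : LpI 𝕜 n p) t ∂muI = 0 := by
      refine integral_eq_zero_of_ae ?_
      filter_upwards [h] with t ht
      rw [ht, Pi.zero_apply, smul_zero]
    simp only [WithLp.zero_fst, WithLp.zero_snd]
    rw [h1, h2, neg_zero]
  add_mem' := by
    intro v w hv hw φ h1 h2 h3
    have key : ∀ (a b : LpI 𝕜 n p) (ψ : ℝ → ℝ), Continuous ψ → HasCompactSupport ψ →
        ∫ t, ψ t • (a + b : LpI 𝕜 n p) t ∂muI
          = ∫ t, ψ t • a t ∂muI + ∫ t, ψ t • b t ∂muI := by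
      intro a b ψ hψ hc
      rw [← integral_add (integrable_test_smul a hψ hc) (integrable_test_smul b hψ hc)]
      refine integral_congr_ae ?_
      filter_upwards [Lp.coeFn_add a b] with t ht
      rw [ht, Pi.add_apply, smul_add]
    have hd : Continuous (deriv φ) := h1.continuous_deriv (by simp)
    simp only [WithLp.add_fst, WithLp.add_snd]
    rw [key _ _ _ hd h2.deriv, key _ _ _ h1.continuous h2, hv φ h1 h2 h3, hw φ h1 h2 h3]
    abel
  smul_mem' := by
    intro c w hw φ h1 h2 h3
    have key : ∀ (a : LpI 𝕜 n p) (ψ : ℝ → ℝ),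
        ∫ t, ψ t • (c • a : LpI 𝕜 n p) t ∂muI = c • ∫ t, ψ t • a t ∂muI := by
      intro a ψ
      rw [← integral_smul]
      refine integral_congr_ae ?_
      filter_upwards [Lp.coeFn_smul c a] with t ht
      rw [ht, Pi.smul_apply, smul_comm]
    simp only [WithLp.smul_fst, WithLp.smul_snd]
    rw [key, key, hw φ h1 h2 h3, smul_neg]

variable {𝕜 n p} in
/-- `a = u(0)` and `b = u(1)`, where `u` is identified with its continuous representative. -/
def HasBoundaryValues [Fact (1 ≤ p)] (u : W1p 𝕜 n p) (a b : EuclideanSpace 𝕜 (Fin n)) : Prop :=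
  ∃ c : ℝ → EuclideanSpace 𝕜 (Fin n), ContinuousOn c (Icc 0 1) ∧
    (u.1.fst : ℝ → EuclideanSpace 𝕜 (Fin n)) =ᵐ[muI] c ∧ c 0 = a ∧ c 1 = b

variable {𝕜 n} in
/-- The domain `{u ∈ W^{1,p}(I, 𝕜ⁿ) : (u(0), u(1)) ∈ S}` for a subspace `S` of
`𝕜²ⁿ = 𝕜ⁿ × 𝕜ⁿ`. -/
def bvpDomain [Fact (1 ≤ p)]
    (S : Submodule 𝕜 (EuclideanSpace 𝕜 (Fin n) × EuclideanSpace 𝕜 (Fin n))) :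
    Submodule 𝕜 (W1p 𝕜 n p) where
  carrier := {u | ∃ a b, HasBoundaryValues u a b ∧ (a, b) ∈ S}
  zero_mem' := by
    refine ⟨0, 0, ⟨0, continuousOn_const, ?_, rfl, rfl⟩, S.zero_mem⟩
    exact Lp.coeFn_zero _ _ _
  add_mem' := by
    rintro u v ⟨a, b, ⟨c, hc, huc, rfl, rfl⟩, hS⟩ ⟨a', b', ⟨d, hd, hvd, rfl, rfl⟩, hS'⟩
    refine ⟨_, _, ⟨c + d, hc.add hd, ?_, rfl, rfl⟩, S.add_mem hS hS'⟩
    exact (Lp.coeFn_add u.1.fst v.1.fst).trans (huc.add hvd)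
  smul_mem' := by
    rintro k u ⟨a, b, ⟨c, hc, huc, rfl, rfl⟩, hS⟩
    refine ⟨_, _, ⟨k • c, hc.const_smul k, ?_, rfl, rfl⟩, S.smul_mem k hS⟩
    exact (Lp.coeFn_smul k u.1.fst).trans (huc.const_smul k)

/-- The derivative `u ↦ u'` as a bounded operator `W^{1,p}(I, 𝕜ⁿ) → L^p(I, 𝕜ⁿ)`. -/
def derivOp [Fact (1 ≤ p)] : W1p 𝕜 n p →L[𝕜] LpI 𝕜 n p :=
  (WithLp.sndL p 𝕜 (LpI 𝕜 n p) (LpI 𝕜 n p)).comp (W1p 𝕜 n p).subtypeL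

variable {𝕜 n} in
/-- The operator `u ↦ u'` with domain `{u ∈ W^{1,p}(I, 𝕜ⁿ) : (u(0), u(1)) ∈ S}`. -/
def bvpOp [Fact (1 ≤ p)]
    (S : Submodule 𝕜 (EuclideanSpace 𝕜 (Fin n) × EuclideanSpace 𝕜 (Fin n))) :
    bvpDomain p S →L[𝕜] LpI 𝕜 n p :=
  (derivOp 𝕜 n p).comp (bvpDomain p S).subtypeL

end Sobolev

end IndexBundle

end

/-! Every `u` in `W1p` is `u(0) + ∫₀ᵗ u'`, so `sobolevEquiv` identifies `W1p` with `𝕜ⁿ × L^p`.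
Equivalently, `(boundaryOp u, derivOp u)` runs over all pairs `((a, b), f)` with `∫ f = b - a`. Only
this linear algebra of `u'` and its boundary values enters the two main constructions.

From invertibility to stable triviality: by compactness of `X` the operators `u ↦ u' + K_x u` are
bounded below on their domains with one constant `C` (`exists_uniform_bound_of_isInvertible`).
Conditional expectations onto finite σ-algebras are finite rank contractions of `L^p` that almost
fix any given finite set, also for `p = ∞`. Hence one finite rank `Q` makes `Q K_x` uniformly close
to `K_x` (`exists_finiteRank_comp_approx`), and `u ↦ u' + Q K_x u` is still injective. Let `G` be
the range of `Q` plus the constants. Functions with derivative in `G` are parametrized by their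
boundary values `z` and the mean-zero part `m ∈ G` of the derivative, and on them the operator takes
values in `G`. With `z` restricted to `V x` the dimensions agree, so injectivity gives `V ⊕ Θ(G₀) ≅
Θ(G)`, where `G₀` is the mean-zero part of `G` (`stablyTrivial_of_injective_of_finiteRank`).

Conversely, a stable trivialization is a continuous family `T_x` mapping `V_x ⊕ 𝕜ᵐ` bijectively onto
`𝕜ⁿ ⊕ 𝕜ᵐ`. Embed `𝕜ⁿ` in `L^p` as the constants and `𝕜ᵐ` as a complemented space of mean-zero
functions. Replacing the component of `u'` in the sum of these two spaces by `T_x` of the boundary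
values and the `𝕜ᵐ`-component is a finite rank perturbation that makes the problem bijective
(`exists_bijective_perturbation`). -/

noncomputable section

namespace IndexBundle

/-! ### Uniform and `L^p` approximation by simple functions, including `p = ∞`. -/

section Approximation

open scoped ENNReal

variable {α : Type*} [MeasurableSpace α] {μ : Measure α}

/-- Functions in `L^∞` with values in a proper space are uniform limits of simple functions. -/
theorem exists_simpleFunc_eLpNorm_top_sub_le {E : Type*} [NormedAddCommGroup E] [ProperSpace E]
    {f : α → E} (hf : MemLp f ∞ μ) {ε : ℝ} (hε : 0 < ε) :
    ∃ s : SimpleFunc α E, eLpNorm (f - ⇑s) ∞ μ ≤ ENNReal.ofReal ε := by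
  borelize E
  obtain ⟨R, hR⟩ : ∃ R : ℝ, ∀ᵐ x ∂μ, ‖f x‖ ≤ R := by
    refine ⟨(eLpNorm f ∞ μ).toReal, ?_⟩
    filter_upwards [ae_le_eLpNormEssSup (f := f) (μ := μ)] with x hx
    have h := hf.2.ne
    rw [eLpNorm_exponent_top] at h ⊢
    rw [← toReal_enorm]
    exact ENNReal.toReal_mono h hx
  let e := TopologicalSpace.denseSeq E
  -- Properness makes the essential range relatively compact, so finitely many balls about points of
  -- a dense sequence cover it.
  obtain ⟨t, ht⟩ := (isCompact_closedBall (0 : E) R).elim_finite_subcover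
    (fun k => Metric.ball (e k) ε) (fun k => Metric.isOpen_ball) (by
      intro x _
      obtain ⟨k, hk⟩ := (TopologicalSpace.denseRange_denseSeq E).exists_dist_lt x hε
      exact mem_iUnion.2 ⟨k, hk⟩)
  let f' := hf.1.mk f
  have hf' : Measurable f' := hf.1.stronglyMeasurable_mk.measurable
  -- `t.sup id` is the largest index in the subcover, so every selected centre is a candidate for
  -- the nearest point.
  refine ⟨(SimpleFunc.nearestPt e (t.sup id)).comp f' hf', ?_⟩
  refine eLpNormEssSup_le_of_ae_bound ?_ |>.trans' (by rw [eLpNorm_exponent_top])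
  filter_upwards [hR, hf.1.ae_eq_mk] with x hx hx'
  have hmem : f x ∈ Metric.closedBall (0 : E) R := by simpa using hx
  obtain ⟨k, hk, hxk⟩ := mem_iUnion₂.1 (ht hmem)
  have h1 := SimpleFunc.edist_nearestPt_le e (f' x) (k := k) (N := t.sup id)
    (Finset.le_sup (f := id) hk)
  have h2 : dist (SimpleFunc.nearestPt e (t.sup id) (f' x)) (f' x) ≤ dist (e k) (f' x) := by
    rw [edist_dist, edist_dist] at h1
    exact (ENNReal.ofReal_le_ofReal_iff dist_nonneg).1 h1
  have hxx : f x = f' x := hx'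
  rw [Pi.sub_apply, SimpleFunc.coe_comp, Function.comp_apply, hxx, ← dist_eq_norm, dist_comm]
  refine h2.trans ?_
  rw [dist_comm, ← hxx]
  exact (Metric.mem_ball.1 hxk).le

theorem exists_simpleFunc_eLpNorm_sub_le {E : Type*} [NormedAddCommGroup E] [ProperSpace E]
    {p : ℝ≥0∞} {f : α → E} (hf : MemLp f p μ) {ε : ℝ} (hε : 0 < ε) :
    ∃ s : SimpleFunc α E, eLpNorm (f - ⇑s) p μ ≤ ENNReal.ofReal ε := by
  by_cases hp : p = ∞
  · subst hp
    exact exists_simpleFunc_eLpNorm_top_sub_le hf hε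
  · obtain ⟨s, hs, -⟩ := hf.exists_simpleFunc_eLpNorm_sub_lt hp
      (ε := ENNReal.ofReal ε) (by simpa using hε)
    exact ⟨s, hs.le⟩

end Approximation

/-! ### Metric approximation property of `L^p` by conditional expectations. -/

section ConditionalExpectation

open scoped ENNReal

variable {α : Type*} (m : MeasurableSpace α) [MeasurableSpace α]

/-- Conditional expectation as a contraction of `L^p`. -/
def condExpLp (𝕜 : Type*) [RCLike 𝕜] (n : ℕ) (p : ℝ≥0∞) [Fact (1 ≤ p)]
    (μ : Measure α) [IsFiniteMeasure μ] :
    Lp (EuclideanSpace 𝕜 (Fin n)) p μ →L[𝕜] Lp (EuclideanSpace 𝕜 (Fin n)) p μ :=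
  LinearMap.mkContinuous
    { toFun := fun f => ((Lp.memLp f).condExp (m := m) Fact.out).toLp _
      map_add' := by
        intro f g
        rw [← MemLp.toLp_add]
        refine MemLp.toLp_congr _ _ ?_
        refine (condExp_congr_ae (Lp.coeFn_add f g)).trans ?_
        exact condExp_add ((Lp.memLp f).integrable Fact.out) ((Lp.memLp g).integrable Fact.out) m
      map_smul' := by
        intro c f
        rw [RingHom.id_apply, ← MemLp.toLp_const_smul]
        refine MemLp.toLp_congr _ _ ?_
        refine (condExp_congr_ae (Lp.coeFn_smul c f)).trans ?_
        exact condExp_smul c _ m }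
    1 (by
      intro f
      rw [one_mul, LinearMap.coe_mk, AddHom.coe_mk, Lp.norm_toLp, Lp.norm_def]
      exact ENNReal.toReal_mono (Lp.memLp f).2.ne (eLpNorm_condExp_le_eLpNorm _ Fact.out))

variable {𝕜 : Type*} [RCLike 𝕜] {n : ℕ} {p : ℝ≥0∞} [Fact (1 ≤ p)]
  {μ : Measure α} [IsFiniteMeasure μ]

theorem coeFn_condExpLp (f : Lp (EuclideanSpace 𝕜 (Fin n)) p μ) :
    (condExpLp m 𝕜 n p μ f : α → EuclideanSpace 𝕜 (Fin n)) =ᵐ[μ] μ[f | m] :=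
  MemLp.coeFn_toLp ((Lp.memLp f).condExp (m := m) Fact.out)

theorem norm_condExpLp_le : ‖condExpLp m 𝕜 n p μ‖ ≤ 1 :=
  LinearMap.mkContinuous_norm_le _ zero_le_one _

variable {m} in
theorem condExpLp_toLp_of_measurable (hm : m ≤ ‹MeasurableSpace α›)
    {s : α → EuclideanSpace 𝕜 (Fin n)} (hs : MemLp s p μ) (hsm : Measurable[m] s) :
    condExpLp m 𝕜 n p μ (hs.toLp s) = hs.toLp s := by
  apply Lp.ext
  refine (coeFn_condExpLp m _).trans ?_
  refine (condExp_congr_ae hs.coeFn_toLp).trans (Filter.EventuallyEq.trans ?_ hs.coeFn_toLp.symm)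
  rw [condExp_of_stronglyMeasurable hm hsm.stronglyMeasurable (hs.integrable Fact.out)]

/-- A function measurable for the σ-algebra generated by `τ` factors through `τ`, so it is
determined by its values on the finite set `range τ`. -/
theorem finiteDimensional_range_condExpLp {β : Type*} [mβ : MeasurableSpace β]
    [MeasurableSingletonClass β] {τ : α → β} (hτ : Measurable τ) (hfin : (range τ).Finite) :
    FiniteDimensional 𝕜 (condExpLp (mβ.comap τ) 𝕜 n p μ).range := by
  classical
  have := hfin.fintype
  have hmem : ∀ h : range τ → EuclideanSpace 𝕜 (Fin n),
      MemLp (fun a => h ⟨τ a, mem_range_self a⟩) p μ := by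
    intro h
    refine MemLp.of_bound (C := ∑ b, ‖h b‖) ?_ (.of_forall fun a => ?_)
    · have : Measurable h := measurable_of_countable h
      exact (this.comp (hτ.subtype_mk (h := fun a => mem_range_self a))).aestronglyMeasurable
    · exact Finset.single_le_sum (f := fun b => ‖h b‖) (fun _ _ => norm_nonneg _)
        (Finset.mem_univ _)
  let Ψ : (range τ → EuclideanSpace 𝕜 (Fin n)) →ₗ[𝕜] Lp (EuclideanSpace 𝕜 (Fin n)) p μ :=
    { toFun := fun h => (hmem h).toLp _
      map_add' := fun h k => MemLp.toLp_add _ _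
      map_smul' := fun c h => MemLp.toLp_const_smul c _ }
  refine Submodule.finiteDimensional_of_le (S₂ := Ψ.range) ?_
  rintro _ ⟨f, rfl⟩
  obtain ⟨h, -, hh⟩ := (stronglyMeasurable_condExp (f := f) (m := mβ.comap τ)
    (μ := μ)).exists_eq_measurable_comp
  refine ⟨fun b => h b, Lp.ext ?_⟩
  refine (MemLp.coeFn_toLp (hmem fun b => h b)).trans
    (Filter.EventuallyEq.trans ?_ (coeFn_condExpLp _ f).symm)
  rw [hh]
  rfl

/-- Finitely many elements of `L^p` are almost fixed by a contraction of finite rank. -/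
theorem exists_finiteRank_approx_finset (t : Finset (Lp (EuclideanSpace 𝕜 (Fin n)) p μ))
    {ε : ℝ} (hε : 0 < ε) :
    ∃ Q : Lp (EuclideanSpace 𝕜 (Fin n)) p μ →L[𝕜] Lp (EuclideanSpace 𝕜 (Fin n)) p μ,
      ‖Q‖ ≤ 1 ∧ FiniteDimensional 𝕜 Q.range ∧ ∀ f ∈ t, ‖Q f - f‖ ≤ ε := by
  have hs : ∀ f : Lp (EuclideanSpace 𝕜 (Fin n)) p μ, ∃ s : SimpleFunc α (EuclideanSpace 𝕜 (Fin n)),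
      eLpNorm ((f : α → EuclideanSpace 𝕜 (Fin n)) - ⇑s) p μ ≤ ENNReal.ofReal (ε / 2) :=
    fun f => exists_simpleFunc_eLpNorm_sub_le (Lp.memLp f) (half_pos hε)
  choose s hs using hs
  -- All approximating simple functions are collected in one map of finite range. Each of them is
  -- measurable for the σ-algebra it generates, hence fixed by the conditional expectation.
  let τ : α → (t → EuclideanSpace 𝕜 (Fin n)) := fun a f => s f a
  have hτ : Measurable τ := measurable_pi_lambda _ fun f => (s f).measurable
  have hfin : (range τ).Finite := by
    refine (Set.Finite.pi' fun f : t => (s f).finite_range).subset ?_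
    rintro _ ⟨a, rfl⟩ f
    exact mem_range_self a
  refine ⟨condExpLp (MeasurableSpace.comap τ inferInstance) 𝕜 n p μ, norm_condExpLp_le _,
    finiteDimensional_range_condExpLp hτ hfin, fun f hf => ?_⟩
  have hsm : MemLp (s f) p μ := (s f).memLp_of_isFiniteMeasure p μ
  have hfg : ‖f - hsm.toLp (s f)‖ ≤ ε / 2 := by
    rw [Lp.norm_def]
    refine ENNReal.toReal_le_of_le_ofReal (half_pos hε).le ((eLpNorm_congr_ae ?_).trans_le (hs f))
    filter_upwards [Lp.coeFn_sub f (hsm.toLp (s f)), hsm.coeFn_toLp] with a ha hb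
    rw [ha, Pi.sub_apply, Pi.sub_apply, hb]
  have hg := condExpLp_toLp_of_measurable hτ.comap_le hsm
    ((measurable_pi_apply (⟨f, hf⟩ : t)).comp (comap_measurable τ))
  have hQ : ‖condExpLp (MeasurableSpace.comap τ inferInstance) 𝕜 n p μ‖ ≤ 1 := norm_condExpLp_le _
  generalize condExpLp (MeasurableSpace.comap τ inferInstance) 𝕜 n p μ = Q at hg hQ
  generalize hsm.toLp (s f) = g at hfg hg
  calc ‖Q f - f‖ = ‖Q (f - g) - (f - g)‖ := by
        rw [map_sub, hg]; congr 1; abel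
    _ ≤ ‖Q (f - g)‖ + ‖f - g‖ := norm_sub_le _ _
    _ ≤ 1 * ‖f - g‖ + ‖f - g‖ := by
        gcongr
        exact Q.le_of_opNorm_le hQ _
    _ ≤ ε := by linarith

end ConditionalExpectation

/-! ### Finite rank approximation of a compact family of compact operators. -/

section CompactFamily

variable {𝕜 : Type*} [RCLike 𝕜] {X : Type*} [TopologicalSpace X] [CompactSpace X]
  {W Y : Type*} [NormedAddCommGroup W] [NormedSpace 𝕜 W] [NormedAddCommGroup Y] [NormedSpace 𝕜 Y]

/-- A norm-continuous family of compact operators into a space with the metric approximation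
property is uniformly approximated by its compositions with a finite rank operator. -/
theorem exists_finiteRank_comp_approx
    (hY : ∀ (t : Finset Y) (ε : ℝ), 0 < ε →
      ∃ Q : Y →L[𝕜] Y, ‖Q‖ ≤ 1 ∧ FiniteDimensional 𝕜 Q.range ∧ ∀ f ∈ t, ‖Q f - f‖ ≤ ε)
    {K : X → (W →L[𝕜] Y)} (hK : Continuous K) (hc : ∀ x, IsCompactOperator (K x))
    {ε : ℝ} (hε : 0 < ε) :
    ∃ Q : Y →L[𝕜] Y, FiniteDimensional 𝕜 Q.range ∧ ∀ x u, ‖Q (K x u) - K x u‖ ≤ ε * ‖u‖ := by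
  classical
  -- The final estimate has three terms, `‖Q (K x u - y)‖ ≤ 2δ`, `‖Q y - y‖ ≤ δ` and `‖K x u - y‖ ≤
  -- 2δ`.
  set δ := ε / 5 with hδ
  have hδ0 : 0 < δ := by positivity
  obtain ⟨s, hs⟩ := isCompact_univ.elim_finite_subcover
    (fun x => {y | ‖K y - K x‖ < δ}) (fun x => isOpen_lt (by fun_prop) continuous_const)
    (fun x _ => mem_iUnion.2 ⟨x, by simpa using hδ0⟩)
  have hnet : ∀ x, ∃ t : Finset Y, ∀ u : W, ‖u‖ ≤ 1 → ∃ y ∈ t, ‖K x u - y‖ < δ := by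
    intro x
    have h := ((hc x).isCompact_closure_image_closedBall
      (f := (K x : W →ₗ[𝕜] Y)) 1).totallyBounded.subset subset_closure
    obtain ⟨t, ht, hcov⟩ := Metric.totallyBounded_iff.1 h δ hδ0
    refine ⟨ht.toFinset, fun u hu => ?_⟩
    obtain ⟨y, hy, hyu⟩ := mem_iUnion₂.1 (hcov (mem_image_of_mem _ (by simpa using hu)))
    exact ⟨y, by simpa using hy, by simpa [dist_eq_norm] using hyu⟩
  choose t ht using hnet
  -- The `δ`-nets of the finitely many `K i` together form a finite `2δ`-net for the images of the
  -- unit ball under all `K x`.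
  obtain ⟨Q, hQ, hfin, hQt⟩ := hY (s.biUnion t) δ hδ0
  refine ⟨Q, hfin, fun x u => ?_⟩
  have hone : ∀ u : W, ‖u‖ ≤ 1 → ‖Q (K x u) - K x u‖ ≤ ε := by
    intro u hu
    obtain ⟨i, hi, hxi⟩ := mem_iUnion₂.1 (hs (mem_univ x))
    obtain ⟨y, hy, hyu⟩ := ht i u hu
    have h1 : ‖K x u - y‖ ≤ 2 * δ := by
      have : K x u - y = (K x - K i) u + (K i u - y) := by simp
      rw [this]
      have h2 : ‖(K x - K i) u‖ ≤ δ := by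
        refine ((K x - K i).le_of_opNorm_le (le_of_lt hxi) u).trans ?_
        nlinarith
      linarith [norm_add_le ((K x - K i) u) (K i u - y)]
    have h3 := hQt y (Finset.mem_biUnion.2 ⟨i, hi, hy⟩)
    have h4 : ‖Q (K x u - y)‖ ≤ 2 * δ := by
      refine (Q.le_of_opNorm_le hQ _).trans ?_
      linarith
    have : Q (K x u) - K x u = Q (K x u - y) + (Q y - y) - (K x u - y) := by
      rw [map_sub]; abel
    rw [this]
    have h5 := norm_sub_le (Q (K x u - y) + (Q y - y)) (K x u - y)
    have h6 := norm_add_le (Q (K x u - y)) (Q y - y)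
    linarith
  by_cases hu : u = 0
  · simp [hu]
  · have hu' : ‖u‖ ≠ 0 := by simpa using hu
    have := hone (((‖u‖⁻¹ : ℝ) : 𝕜) • u) (by
      rw [norm_smul, RCLike.norm_ofReal, abs_of_nonneg (by positivity), inv_mul_cancel₀ hu'])
    rw [map_smul, map_smul, ← smul_sub, norm_smul, RCLike.norm_ofReal,
      abs_of_nonneg (by positivity), inv_mul_le_iff₀ (by positivity)] at this
    linarith

end CompactFamily

/-! ### Weak derivatives on the unit interval. -/

section WeakDerivative

open scoped ENNReal ContDiff

variable {𝕜 : Type*} [RCLike 𝕜] {n : ℕ}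

theorem muI_univ : muI univ = 1 := by simp [muI]

instance : IsProbabilityMeasure muI := ⟨muI_univ⟩

/-- Outside `(0, 1)` the integral of a test function does not see `muI`. -/
theorem integral_muI_eq_of_tsupport_subset {φ : ℝ → ℝ} (h : tsupport φ ⊆ Ioo 0 1) :
    ∫ t, φ t ∂muI = ∫ t, φ t := by
  refine setIntegral_eq_integral_of_forall_compl_eq_zero fun t ht => ?_
  by_contra h0
  exact ht (Ioo_subset_Icc_self (h (subset_tsupport φ h0)))

theorem exists_testFunction_integral_eq_one :
    ∃ ρ : ℝ → ℝ, ContDiff ℝ (⊤ : ℕ∞) ρ ∧ HasCompactSupport ρ ∧ tsupport ρ ⊆ Ioo 0 1 ∧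
      ∫ t, ρ t ∂muI = 1 := by
  let b : ContDiffBump (1 / 2 : ℝ) := ⟨1 / 8, 1 / 4, by norm_num, by norm_num⟩
  have hsub : tsupport (b.normed volume) ⊆ Ioo 0 1 := by
    rw [b.tsupport_normed_eq, Real.closedBall_eq_Icc]
    intro t ht
    have h1 : (1 / 2 : ℝ) - 1 / 4 ≤ t := ht.1
    have h2 : t ≤ (1 / 2 : ℝ) + 1 / 4 := ht.2
    constructor <;> linarith
  refine ⟨b.normed volume, b.contDiff_normed, b.hasCompactSupport_normed, hsub, ?_⟩
  rw [integral_muI_eq_of_tsupport_subset hsub, b.integral_normed]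

/-- A test function with integral zero is the derivative of a test function. -/
theorem exists_testFunction_deriv_eq {θ : ℝ → ℝ} (h1 : ContDiff ℝ (⊤ : ℕ∞) θ)
    (h2 : HasCompactSupport θ) (h3 : tsupport θ ⊆ Ioo 0 1) (h4 : ∫ t, θ t = 0) :
    ∃ φ : ℝ → ℝ, ContDiff ℝ (⊤ : ℕ∞) φ ∧ HasCompactSupport φ ∧ tsupport φ ⊆ Ioo 0 1 ∧
      deriv φ = θ := by
  -- The primitive vanishes to the left of the support, and to its right because `∫ θ = 0`. A
  -- compact interval inside `(0, 1)` therefore contains its support too. For `θ = 0` the pair `(1,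
  -- 0)` gives the empty interval.
  obtain ⟨a, b, ha, hb, hab⟩ : ∃ a b : ℝ, 0 < a ∧ b < 1 ∧ tsupport θ ⊆ Icc a b := by
    rcases (tsupport θ).eq_empty_or_nonempty with he | hne
    · exact ⟨1, 0, one_pos, zero_lt_one, by simp [he]⟩
    · have hc : IsCompact (tsupport θ) := h2
      exact ⟨sInf (tsupport θ), sSup (tsupport θ), (h3 (hc.sInf_mem hne)).1,
        (h3 (hc.sSup_mem hne)).2, fun t ht => ⟨csInf_le hc.bddBelow ht, le_csSup hc.bddAbove ht⟩⟩
  have hz : ∀ t, t ∉ Icc a b → θ t = 0 := fun t ht => by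
    by_contra h0
    exact ht (hab (subset_tsupport θ h0))
  have hd : ∀ t, HasDerivAt (fun t => ∫ s in (0 : ℝ)..t, θ s) (θ t) t := fun t =>
    intervalIntegral.integral_hasDerivAt_right (h1.continuous.intervalIntegrable _ _)
      (h1.continuous.stronglyMeasurableAtFilter _ _) h1.continuous.continuousAt
  have hderiv : deriv (fun t => ∫ s in (0 : ℝ)..t, θ s) = θ := funext fun t => (hd t).deriv
  have hsupp : Function.support (fun t => ∫ s in (0 : ℝ)..t, θ s) ⊆ Icc a b := by
    intro t ht
    by_contra hout
    apply ht
    rcases not_and_or.1 hout with h | h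
    · have h' : t < a := not_le.1 h
      refine intervalIntegral.integral_zero_ae (.of_forall fun s hs => hz s fun hs' => ?_)
      have := hs.2.trans (max_le ha.le h'.le)
      have h0 := hs'.1
      have h5 : s = a := le_antisymm this h0
      rcases le_max_iff.1 hs.2 with h6 | h6 <;> linarith
    · have h' : b < t := not_le.1 h
      change ∫ s in (0 : ℝ)..t, θ s = 0
      by_cases ht0 : 0 ≤ t
      · rw [intervalIntegral.integral_of_le ht0]
        refine Eq.trans ?_ h4
        refine setIntegral_eq_integral_of_forall_compl_eq_zero fun s hs => hz s fun hs' => hs ?_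
        exact ⟨ha.trans_le hs'.1, hs'.2.trans h'.le⟩
      · refine intervalIntegral.integral_zero_ae (.of_forall fun s hs => hz s fun hs' => ?_)
        have h7 := hs'.1.trans hs'.2
        linarith
  have hts : tsupport (fun t => ∫ s in (0 : ℝ)..t, θ s) ⊆ Icc a b :=
    closure_minimal hsupp isClosed_Icc
  refine ⟨fun t => ∫ s in (0 : ℝ)..t, θ s, ?_, ?_, ?_, hderiv⟩
  · rw [contDiff_infty_iff_deriv, hderiv]
    exact ⟨fun t => (hd t).differentiableAt, h1⟩
  · exact HasCompactSupport.of_support_subset_isCompact isCompact_Icc hsupp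
  · exact hts.trans fun t ht => ⟨ha.trans_le ht.1, ht.2.trans_lt hb⟩

theorem ae_muI_mem_Ioo : ∀ᵐ t ∂muI, t ∈ Ioo (0 : ℝ) 1 := by
  have : muI = volume.restrict (Ioo (0 : ℝ) 1) := (Measure.restrict_congr_set Ioo_ae_eq_Icc).symm
  rw [this]
  exact ae_restrict_mem measurableSet_Ioo

theorem integrable_smul_muI {ψ : ℝ → ℝ} (hψ : Continuous ψ) (hc : HasCompactSupport ψ)
    {h : ℝ → EuclideanSpace 𝕜 (Fin n)} (hh : Integrable h muI) :
    Integrable (fun t => ψ t • h t) muI := by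
  obtain ⟨C, hC⟩ := hψ.bounded_above_of_compact_support hc
  exact hh.bdd_smul C hψ.aestronglyMeasurable (Filter.Eventually.of_forall hC)

/-- The lemma of du Bois-Reymond: a function with weak derivative zero is constant. -/
theorem ae_eq_const_of_forall_integral_deriv_smul_eq_zero
    {h : ℝ → EuclideanSpace 𝕜 (Fin n)} (hh : Integrable h muI)
    (hw : ∀ φ : ℝ → ℝ, ContDiff ℝ (⊤ : ℕ∞) φ → HasCompactSupport φ → tsupport φ ⊆ Ioo 0 1 →
      ∫ t, deriv φ t • h t ∂muI = 0) :
    ∃ c, h =ᵐ[muI] fun _ => c := by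
  obtain ⟨ρ, r1, r2, r3, r4⟩ := exists_testFunction_integral_eq_one
  refine ⟨∫ t, ρ t • h t ∂muI, ?_⟩
  set c := ∫ t, ρ t • h t ∂muI
  have key : ∀ᵐ t ∂muI, t ∈ Ioo (0 : ℝ) 1 → h t - c = 0 := by
    refine isOpen_Ioo.ae_eq_zero_of_integral_contDiff_smul_eq_zero
      ((hh.sub (integrable_const c)).locallyIntegrable.locallyIntegrableOn _) ?_
    intro ψ p1 p2 p3
    set I := ∫ t, ψ t ∂muI with hI
    have hts : tsupport (fun t => ψ t - I * ρ t) ⊆ tsupport ψ ∪ tsupport ρ := by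
      refine closure_minimal (fun t ht => ?_) (isClosed_tsupport ψ |>.union (isClosed_tsupport ρ))
      by_contra hout
      rw [mem_union, not_or] at hout
      exact ht (by simp [image_eq_zero_of_notMem_tsupport hout.1,
        image_eq_zero_of_notMem_tsupport hout.2])
    have hψi : Integrable ψ muI := (p1.continuous.integrable_of_hasCompactSupport p2)
    have hρi : Integrable ρ muI := (r1.continuous.integrable_of_hasCompactSupport r2)
    -- Subtracting `I * ρ` from `ψ` makes the integral zero, so the difference is the derivative of
    -- a test function and `hw` applies. The subtracted term produces exactly the constant `c`.
    obtain ⟨φ, f1, f2, f3, f4⟩ := exists_testFunction_deriv_eq (θ := fun t => ψ t - I * ρ t)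
      (p1.sub (contDiff_const.mul r1))
      (HasCompactSupport.of_support_subset_isCompact (p2.isCompact.union r2.isCompact)
        ((subset_tsupport _).trans hts)) (hts.trans (union_subset p3 r3)) (by
        rw [← integral_muI_eq_of_tsupport_subset (hts.trans (union_subset p3 r3)),
          integral_sub hψi (hρi.const_mul I), integral_const_mul, r4, mul_one, sub_self])
    have h0 := hw φ f1 f2 f3
    rw [f4] at h0
    have e1 : ∀ t, (ψ t - I * ρ t) • h t = ψ t • h t - I • ρ t • h t := fun t => by
      rw [sub_smul, mul_smul]
    simp only [e1] at h0
    rw [integral_sub (integrable_smul_muI p1.continuous p2 hh)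
      (by exact (integrable_smul_muI r1.continuous r2 hh).smul I), integral_smul] at h0
    simp only [smul_sub]
    rw [integral_sub (integrable_smul_muI p1.continuous p2 hh) (hψi.smul_const c),
      integral_smul_const]
    exact h0
  filter_upwards [key, ae_muI_mem_Ioo] with t ht ht'
  exact sub_eq_zero.1 (ht ht')

/-- The primitive of an integrable function is a weak antiderivative. -/
theorem isWeakDeriv_primitive {g : ℝ → EuclideanSpace 𝕜 (Fin n)} (hg : Integrable g muI) :
    IsWeakDeriv (fun t => ∫ s in (0 : ℝ)..t, g s ∂muI) g := by
  intro φ h1 h2 h3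
  have hd : Continuous (deriv φ) := h1.continuous_deriv (by simp)
  have hφ0 : ∀ t, t ∉ Ioo (0 : ℝ) 1 → φ t = 0 := fun t ht =>
    image_eq_zero_of_notMem_tsupport fun h => ht (h3 h)
  have hdi : Integrable (deriv φ) muI := hd.integrable_of_hasCompactSupport h2.deriv
  -- Fubini on the triangle `s ≤ t`: after the swap the inner integral is `∫ₛ¹ φ' = -φ(s)`, since
  -- `φ(1) = 0`.
  have e1 : ∫ t, deriv φ t • ∫ s in (0 : ℝ)..t, g s ∂muI ∂muI
      = ∫ t, ∫ s, {q : ℝ × ℝ | q.2 ≤ q.1}.indicator (fun q => deriv φ q.1 • g q.2) (t, s) ∂muI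
        ∂muI := by
    refine integral_congr_ae ?_
    filter_upwards [ae_muI_mem_Ioo] with t ht
    rw [intervalIntegral.integral_of_le ht.1.le, ← integral_smul,
      ← integral_indicator measurableSet_Ioc]
    refine integral_congr_ae ?_
    filter_upwards [ae_muI_mem_Ioo] with s hs
    by_cases hst : s ≤ t
    · rw [indicator_of_mem (show s ∈ Ioc 0 t from ⟨hs.1, hst⟩), indicator_of_mem (by exact hst)]
    · rw [indicator_of_notMem (fun h => hst h.2), indicator_of_notMem (by exact hst)]
  have hint : Integrable (Function.uncurry fun t s =>
      {q : ℝ × ℝ | q.2 ≤ q.1}.indicator (fun q => deriv φ q.1 • g q.2) (t, s))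
      (muI.prod muI) :=
    (hdi.smul_prod hg).indicator (measurableSet_le measurable_snd measurable_fst)
  rw [e1, integral_integral_swap hint, ← integral_neg]
  refine integral_congr_ae ?_
  filter_upwards [ae_muI_mem_Ioo] with s hs
  have e2 : ∀ t, {q : ℝ × ℝ | q.2 ≤ q.1}.indicator (fun q => deriv φ q.1 • g q.2) (t, s)
      = (Ici s).indicator (deriv φ) t • g s := fun t => by
    by_cases hst : s ≤ t
    · rw [indicator_of_mem (by exact hst), indicator_of_mem (by exact hst)]
    · rw [indicator_of_notMem (by exact hst), indicator_of_notMem (by exact hst), zero_smul]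
  simp only [e2]
  rw [integral_smul_const, integral_indicator measurableSet_Ici, Measure.restrict_restrict
    measurableSet_Ici, ← neg_smul]
  congr 1
  have e3 : Ici s ∩ Icc 0 1 = Icc s 1 := by
    ext t
    simp only [mem_inter_iff, mem_Ici, mem_Icc]
    exact ⟨fun h => ⟨h.1, h.2.2⟩, fun h => ⟨h.1, hs.1.le.trans h.1, h.2⟩⟩
  rw [e3, integral_Icc_eq_integral_Ioc, ← intervalIntegral.integral_of_le hs.2.le,
    intervalIntegral.integral_deriv_eq_sub (fun t _ => h1.differentiable (by simp) t)
      (hd.intervalIntegrable _ _), hφ0 1 (by simp), zero_sub]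

end WeakDerivative

/-! ### Structure of `W^{1,p}`: primitives, boundary values and completeness data. -/

section SobolevStructure

open scoped ENNReal

variable {𝕜 : Type*} [RCLike 𝕜] {n : ℕ} {p : ℝ≥0∞} [Fact (1 ≤ p)]

theorem integrable_coeFn (f : LpI 𝕜 n p) : Integrable f muI := (Lp.memLp f).integrable Fact.out

theorem integral_norm_le_norm (f : LpI 𝕜 n p) : ∫ t, ‖f t‖ ∂muI ≤ ‖f‖ := by
  rw [integral_norm_eq_lintegral_enorm (Lp.aestronglyMeasurable f), Lp.norm_def,
    ← eLpNorm_one_eq_lintegral_enorm]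
  exact ENNReal.toReal_mono (Lp.memLp f).2.ne
    (eLpNorm_le_eLpNorm_of_exponent_le Fact.out (Lp.aestronglyMeasurable f))

variable (𝕜 n p)

/-- The mean value `f ↦ ∫₀¹ f`. -/
def meanOp : LpI 𝕜 n p →L[𝕜] EuclideanSpace 𝕜 (Fin n) :=
  LinearMap.mkContinuous
    { toFun := fun f => ∫ t, f t ∂muI
      map_add' := fun f g => by
        rw [← integral_add (integrable_coeFn f) (integrable_coeFn g)]
        exact integral_congr_ae (Lp.coeFn_add f g)
      map_smul' := fun c f => by
        rw [RingHom.id_apply, ← integral_smul]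
        exact integral_congr_ae (Lp.coeFn_smul c f) }
    1 fun f => by
      rw [one_mul]
      exact (norm_integral_le_integral_norm _).trans (integral_norm_le_norm f)

/-- The inclusion of the constant functions. -/
def constOp : EuclideanSpace 𝕜 (Fin n) →L[𝕜] LpI 𝕜 n p := Lp.constL p muI 𝕜

variable {𝕜 n p}

/-- The continuous representative `t ↦ ∫₀ᵗ f` of the primitive of `f`. -/
def primFun (f : LpI 𝕜 n p) (t : ℝ) : EuclideanSpace 𝕜 (Fin n) := ∫ s in (0 : ℝ)..t, f s ∂muI

theorem continuous_primFun (f : LpI 𝕜 n p) : Continuous (primFun f) :=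
  intervalIntegral.continuous_primitive (fun _ _ => (integrable_coeFn f).intervalIntegrable) 0

theorem norm_primFun_le (f : LpI 𝕜 n p) (t : ℝ) : ‖primFun f t‖ ≤ ‖f‖ := by
  refine (intervalIntegral.norm_integral_le_integral_norm_uIoc).trans ?_
  refine (setIntegral_le_integral (integrable_coeFn f).norm
    (.of_forall fun _ => norm_nonneg _)).trans (integral_norm_le_norm f)

theorem primFun_one (f : LpI 𝕜 n p) : primFun f 1 = meanOp 𝕜 n p f := by
  rw [primFun, intervalIntegral.integral_of_le zero_le_one]
  change _ = ∫ t, f t ∂muI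
  rw [Measure.restrict_restrict measurableSet_Ioc, inter_eq_left.2 Ioc_subset_Icc_self,
    integral_Icc_eq_integral_Ioc]

theorem memLp_primFun (f : LpI 𝕜 n p) : MemLp (primFun f) p muI :=
  MemLp.of_bound (continuous_primFun f).aestronglyMeasurable ‖f‖ (.of_forall (norm_primFun_le f))

variable (𝕜 n p)

/-- The primitive `f ↦ ∫₀ᵗ f`. -/
def primOp : LpI 𝕜 n p →L[𝕜] LpI 𝕜 n p :=
  LinearMap.mkContinuous
    { toFun := fun f => (memLp_primFun f).toLp _
      map_add' := fun f g => by
        rw [← MemLp.toLp_add]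
        refine MemLp.toLp_congr _ _ (.of_forall fun t => ?_)
        rw [Pi.add_apply, primFun, primFun, primFun, ← intervalIntegral.integral_add
          (integrable_coeFn f).intervalIntegrable (integrable_coeFn g).intervalIntegrable]
        refine intervalIntegral.integral_congr_ae ?_
        filter_upwards [Lp.coeFn_add f g] with s hs _
        rw [hs, Pi.add_apply]
      map_smul' := fun c f => by
        rw [RingHom.id_apply, ← MemLp.toLp_const_smul]
        refine MemLp.toLp_congr _ _ (.of_forall fun t => ?_)
        rw [Pi.smul_apply, primFun, primFun, ← intervalIntegral.integral_smul]
        refine intervalIntegral.integral_congr_ae ?_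
        filter_upwards [Lp.coeFn_smul c f] with s hs _
        rw [hs, Pi.smul_apply] }
    1 fun f => by
      rw [one_mul, LinearMap.coe_mk, AddHom.coe_mk]
      refine (Lp.norm_le_of_ae_bound (C := ‖f‖) (norm_nonneg f) ?_).trans ?_
      · filter_upwards [(memLp_primFun f).coeFn_toLp] with t ht
        rw [ht]
        exact norm_primFun_le f t
      · simp [measureUnivNNReal]

variable {𝕜 n p}

theorem coeFn_primOp (f : LpI 𝕜 n p) :
    (primOp 𝕜 n p f : ℝ → EuclideanSpace 𝕜 (Fin n)) =ᵐ[muI] primFun f :=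
  (memLp_primFun f).coeFn_toLp

theorem coeFn_constOp (a : EuclideanSpace 𝕜 (Fin n)) :
    (constOp 𝕜 n p a : ℝ → EuclideanSpace 𝕜 (Fin n)) =ᵐ[muI] fun _ => a :=
  Lp.coeFn_const p muI a

@[simp]
theorem meanOp_constOp (a : EuclideanSpace 𝕜 (Fin n)) :
    meanOp 𝕜 n p (constOp 𝕜 n p a) = a := by
  change ∫ t, constOp 𝕜 n p a t ∂muI = a
  rw [integral_congr_ae (coeFn_constOp a)]
  simp

theorem isWeakDeriv_congr {u v g : ℝ → EuclideanSpace 𝕜 (Fin n)} (h : u =ᵐ[muI] v)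
    (hv : IsWeakDeriv v g) : IsWeakDeriv u g := by
  intro φ h1 h2 h3
  rw [← hv φ h1 h2 h3]
  refine integral_congr_ae ?_
  filter_upwards [h] with t ht
  rw [ht]

theorem isWeakDeriv_primOp (f : LpI 𝕜 n p) : IsWeakDeriv (primOp 𝕜 n p f) f :=
  isWeakDeriv_congr (coeFn_primOp f) (isWeakDeriv_primitive (integrable_coeFn f))

theorem isWeakDeriv_const (a : EuclideanSpace 𝕜 (Fin n)) :
    IsWeakDeriv (fun _ => a) (fun _ => 0) := by
  intro φ h1 h2 h3
  have hφ0 : ∀ t, t ∉ Ioo (0 : ℝ) 1 → φ t = 0 := fun t ht =>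
    image_eq_zero_of_notMem_tsupport fun h => ht (h3 h)
  rw [integral_smul_const, integral_Icc_eq_integral_Ioc,
    ← intervalIntegral.integral_of_le zero_le_one,
    intervalIntegral.integral_deriv_eq_sub (fun t _ => h1.differentiable (by simp) t)
      ((h1.continuous_deriv (by simp)).intervalIntegrable _ _), hφ0 1 (by simp), hφ0 0 (by simp)]
  simp

/-- The function `a + ∫₀ᵗ f` as an element of `W^{1,p}`. -/
theorem constOp_add_primOp_mem (a : EuclideanSpace 𝕜 (Fin n)) (f : LpI 𝕜 n p) :
    WithLp.toLp p (constOp 𝕜 n p a + primOp 𝕜 n p f, f) ∈ W1p 𝕜 n p := by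
  have h1 : WithLp.toLp p (primOp 𝕜 n p f, f) ∈ W1p 𝕜 n p := isWeakDeriv_primOp f
  have h2 : WithLp.toLp p (constOp 𝕜 n p a, 0) ∈ W1p 𝕜 n p := by
    change IsWeakDeriv (constOp 𝕜 n p a) (0 : LpI 𝕜 n p)
    intro φ k1 k2 k3
    rw [isWeakDeriv_congr (coeFn_constOp a) (isWeakDeriv_const a) φ k1 k2 k3]
    congr 1
    refine integral_congr_ae ?_
    filter_upwards [Lp.coeFn_zero (EuclideanSpace 𝕜 (Fin n)) p muI] with t ht
    rw [ht, Pi.zero_apply]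
  have := (W1p 𝕜 n p).add_mem h2 h1
  rw [← WithLp.toLp_add, Prod.mk_add_mk, zero_add] at this
  exact this

variable (𝕜 n p)

/-- The left boundary value `u ↦ u(0)`. -/
def leftValue : W1p 𝕜 n p →L[𝕜] EuclideanSpace 𝕜 (Fin n) :=
  -- The function `u - ∫₀ᵗ u'` is the constant `u(0)`, and taking its mean recovers that constant by
  -- a bounded operator.
  (meanOp 𝕜 n p).comp ((WithLp.fstL p 𝕜 (LpI 𝕜 n p) (LpI 𝕜 n p)).comp (W1p 𝕜 n p).subtypeL
    - (primOp 𝕜 n p).comp (derivOp 𝕜 n p))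

/-- The pair of boundary values `u ↦ (u(0), u(1))`. -/
def boundaryOp : W1p 𝕜 n p →L[𝕜] EuclideanSpace 𝕜 (Fin n) × EuclideanSpace 𝕜 (Fin n) :=
  (leftValue 𝕜 n p).prod (leftValue 𝕜 n p + (meanOp 𝕜 n p).comp (derivOp 𝕜 n p))

variable {𝕜 n p}

/-- Every element of `W^{1,p}` is the primitive of its weak derivative. -/
theorem fst_eq_constOp_add_primOp (u : W1p 𝕜 n p) :
    u.1.fst = constOp 𝕜 n p (leftValue 𝕜 n p u) + primOp 𝕜 n p (derivOp 𝕜 n p u) := by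
  set f := derivOp 𝕜 n p u with hf
  set v : LpI 𝕜 n p := u.1.fst - primOp 𝕜 n p f with hv
  have hw : WithLp.toLp p (v, 0) ∈ W1p 𝕜 n p := by
    have h1 : WithLp.toLp p (primOp 𝕜 n p f, f) ∈ W1p 𝕜 n p := isWeakDeriv_primOp f
    have h2 := (W1p 𝕜 n p).sub_mem u.2 h1
    have h3 : u.1 - WithLp.toLp p (primOp 𝕜 n p f, f) = WithLp.toLp p (v, 0) := by
      have : u.1 = WithLp.toLp p (u.1.fst, f) := rfl
      conv_lhs => rw [this]
      rw [← WithLp.toLp_sub, Prod.mk_sub_mk, sub_self]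
    rwa [h3] at h2
  obtain ⟨c, hc⟩ := ae_eq_const_of_forall_integral_deriv_smul_eq_zero (integrable_coeFn v) (by
    intro φ k1 k2 k3
    refine (hw φ k1 k2 k3).trans ?_
    rw [neg_eq_zero]
    refine integral_eq_zero_of_ae ?_
    filter_upwards [Lp.coeFn_zero (EuclideanSpace 𝕜 (Fin n)) p muI] with t ht
    change φ t • (0 : LpI 𝕜 n p) t = 0
    rw [ht, Pi.zero_apply, smul_zero])
  have hvc : v = constOp 𝕜 n p c := Lp.ext (hc.trans (coeFn_constOp c).symm)
  have hl : leftValue 𝕜 n p u = c := by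
    change meanOp 𝕜 n p v = c
    rw [hvc, meanOp_constOp]
  rw [hl, ← hvc, hv, sub_add_cancel]

/-- Continuous functions on `[0, 1]` that agree almost everywhere agree at the endpoints as well.
Boundary values are thus unique and can be read off from the representative `u(0) + ∫₀ᵗ u'`. -/
theorem hasBoundaryValues_iff {u : W1p 𝕜 n p} {a b : EuclideanSpace 𝕜 (Fin n)} :
    HasBoundaryValues u a b ↔ boundaryOp 𝕜 n p u = (a, b) := by
  set f := derivOp 𝕜 n p u with hf
  have hrep : (u.1.fst : ℝ → EuclideanSpace 𝕜 (Fin n)) =ᵐ[muI]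
      fun t => leftValue 𝕜 n p u + primFun f t := by
    rw [fst_eq_constOp_add_primOp u]
    filter_upwards [Lp.coeFn_add (constOp 𝕜 n p (leftValue 𝕜 n p u)) (primOp 𝕜 n p f),
      coeFn_constOp (p := p) (leftValue 𝕜 n p u), coeFn_primOp f] with t h1 h2 h3
    rw [h1, Pi.add_apply, h2, h3]
  have hcont : Continuous fun t => leftValue 𝕜 n p u + primFun f t :=
    continuous_const.add (continuous_primFun f)
  have hb : boundaryOp 𝕜 n p u
      = (leftValue 𝕜 n p u + primFun f 0, leftValue 𝕜 n p u + primFun f 1) := by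
    rw [primFun_one, primFun, intervalIntegral.integral_same, add_zero]
    rfl
  rw [hb, Prod.mk.injEq]
  constructor
  · rintro ⟨c, hc, huc, rfl, rfl⟩
    have := Measure.eqOn_Icc_of_ae_eq volume zero_ne_one (hrep.symm.trans huc)
      hcont.continuousOn hc
    exact ⟨this (by simp), this (by simp)⟩
  · rintro ⟨h0, h1⟩
    exact ⟨_, hcont.continuousOn, hrep, h0, h1⟩

theorem mem_bvpDomain_iff
    {S : Submodule 𝕜 (EuclideanSpace 𝕜 (Fin n) × EuclideanSpace 𝕜 (Fin n))} {u : W1p 𝕜 n p} :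
    u ∈ bvpDomain p S ↔ boundaryOp 𝕜 n p u ∈ S := by
  constructor
  · rintro ⟨a, b, hab, hS⟩
    rwa [hasBoundaryValues_iff.1 hab]
  · intro h
    exact ⟨_, _, hasBoundaryValues_iff.2 rfl, h⟩

variable (𝕜 n p)

/-- `W^{1,p}` is parametrized by the left boundary value and the derivative. -/
def sobolevEquiv : W1p 𝕜 n p ≃L[𝕜] EuclideanSpace 𝕜 (Fin n) × LpI 𝕜 n p :=
  ContinuousLinearEquiv.equivOfInverse ((leftValue 𝕜 n p).prod (derivOp 𝕜 n p))
    (ContinuousLinearMap.codRestrict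
      ((WithLp.prodContinuousLinearEquiv p 𝕜 _ _).symm.toContinuousLinearMap.comp
        (((constOp 𝕜 n p).coprod (primOp 𝕜 n p)).prod (ContinuousLinearMap.snd 𝕜 _ _)))
      (W1p 𝕜 n p) fun q => constOp_add_primOp_mem q.1 q.2)
    (by
      intro u
      apply Subtype.ext
      change WithLp.toLp p (constOp 𝕜 n p (leftValue 𝕜 n p u) + primOp 𝕜 n p (derivOp 𝕜 n p u),
        derivOp 𝕜 n p u) = u.1
      rw [← fst_eq_constOp_add_primOp]
      rfl)
    (by
      rintro ⟨a, f⟩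
      refine Prod.ext ?_ rfl
      change meanOp 𝕜 n p (constOp 𝕜 n p a + primOp 𝕜 n p f - primOp 𝕜 n p f) = a
      rw [add_sub_cancel_right, meanOp_constOp])

variable {𝕜 n p}

theorem leftValue_sobolevEquiv_symm (q : EuclideanSpace 𝕜 (Fin n) × LpI 𝕜 n p) :
    leftValue 𝕜 n p ((sobolevEquiv 𝕜 n p).symm q) = q.1 :=
  congrArg Prod.fst ((sobolevEquiv 𝕜 n p).apply_symm_apply q)

theorem derivOp_sobolevEquiv_symm (q : EuclideanSpace 𝕜 (Fin n) × LpI 𝕜 n p) :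
    derivOp 𝕜 n p ((sobolevEquiv 𝕜 n p).symm q) = q.2 :=
  congrArg Prod.snd ((sobolevEquiv 𝕜 n p).apply_symm_apply q)

end SobolevStructure

/-! ### Uniform lower bounds over a compact parameter space. -/

section UniformBound

open Topology

variable {𝕜 : Type*} [RCLike 𝕜] {X : Type*} [TopologicalSpace X] [CompactSpace X]
  {A B : Type*} [NormedAddCommGroup A] [NormedSpace 𝕜 A] [NormedAddCommGroup B] [NormedSpace 𝕜 B]

/-- A continuous family of operators over a compact space, all of which are bounded below, is
uniformly bounded below. -/
theorem exists_uniform_lower_bound {L : X → (A →L[𝕜] B)} (hL : Continuous L)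
    (h : ∀ x, ∃ C : ℝ, ∀ u, ‖u‖ ≤ C * ‖L x u‖) :
    ∃ C : ℝ, 0 < C ∧ ∀ x u, ‖u‖ ≤ C * ‖L x u‖ := by
  have h' : ∀ x, ∃ C : ℝ, 0 < C ∧ ∀ u, ‖u‖ ≤ C * ‖L x u‖ := fun x => by
    obtain ⟨C, hC⟩ := h x
    refine ⟨max C 1, by positivity, fun u => (hC u).trans ?_⟩
    gcongr
    exact le_max_left _ _
  choose c hc0 hc using h'
  -- A perturbation of norm at most `(2 * c x)⁻¹` costs half of `‖u‖`, so the lower bound survives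
  -- near `x` with constant `2 * c x`.
  obtain ⟨s, hs⟩ := isCompact_univ.elim_finite_subcover
    (fun x => {y | ‖L y - L x‖ < (2 * c x)⁻¹})
    (fun x => isOpen_lt (by fun_prop) continuous_const)
    (fun x _ => mem_iUnion.2 ⟨x, by simpa using hc0 x⟩)
  -- The sum dominates each local constant; the summand `1` keeps it positive when `s` is empty.
  refine ⟨∑ x ∈ s, 2 * c x + 1, add_pos_of_nonneg_of_pos
    (Finset.sum_nonneg fun x _ => by linarith [hc0 x]) one_pos, fun y u => ?_⟩
  obtain ⟨x, hx, hxy⟩ := mem_iUnion₂.1 (hs (mem_univ y))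
  have hxy' : ‖L y - L x‖ ≤ (2 * c x)⁻¹ := le_of_lt hxy
  have h1 : ‖L x u‖ ≤ ‖L y u‖ + (2 * c x)⁻¹ * ‖u‖ := by
    have e : L x u = L y u - (L y - L x) u := by simp
    rw [e]
    exact (norm_sub_le _ _).trans (by gcongr; exact (L y - L x).le_of_opNorm_le hxy' u)
  have h2 : ‖u‖ ≤ 2 * c x * ‖L y u‖ := by
    have h3 := (hc x u).trans (mul_le_mul_of_nonneg_left h1 (hc0 x).le)
    have h4 : c x * ((2 * c x)⁻¹ * ‖u‖) = ‖u‖ / 2 := by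
      have := (hc0 x).ne'
      field_simp
    rw [mul_add, h4] at h3
    linarith
  refine h2.trans ?_
  gcongr
  have := Finset.single_le_sum (f := fun x => 2 * c x) (fun x _ => by linarith [hc0 x]) hx
  linarith

end UniformBound

/-! ### Subbundles as ranges of projections, and bundle isomorphisms from families of linear maps.
-/

section BundleLemmas

open Topology

variable {𝕜 X : Type*} [RCLike 𝕜] [TopologicalSpace X]
  {E F G : Type*} [NormedAddCommGroup E] [NormedSpace 𝕜 E]
  [NormedAddCommGroup F] [NormedSpace 𝕜 F] [NormedAddCommGroup G] [NormedSpace 𝕜 G]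
  {n : ℕ} {V : X → Submodule 𝕜 E}

/-- A subbundle has local frames. -/
theorem IsSubbundle.exists_local_frame (hV : IsSubbundle n V) (x : X) :
    ∃ U : Set X, IsOpen U ∧ x ∈ U ∧ ∃ B : U → (EuclideanSpace 𝕜 (Fin n) →L[𝕜] E),
      Continuous B ∧ (∀ y, Function.Injective (B y)) ∧ ∀ y : U, (B y).range = V y := by
  obtain ⟨U, hU, hx, φ, -, hφ⟩ := hV x
  let B : U → (EuclideanSpace 𝕜 (Fin n) →ₗ[𝕜] E) := fun y =>
    (V y).subtype ∘ₗ (φ y).symm.toLinearMap ∘ₗ (LinearMap.id.codRestrict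
      (Theta 𝕜 U (EuclideanSpace 𝕜 (Fin n)) y) fun _ => Submodule.mem_top)
  refine ⟨U, hU, hx, fun y => LinearMap.toContinuousLinearMap (B y), ?_, fun y v w h => ?_,
    fun y => ?_⟩
  · refine continuous_clm_apply.2 fun v => ?_
    have hc : Continuous fun y : U => (⟨(y, v), Submodule.mem_top⟩ :
        Total (Theta 𝕜 U (EuclideanSpace 𝕜 (Fin n)))) :=
      Continuous.subtype_mk (continuous_id.prodMk continuous_const) _
    exact hφ.comp hc
  · have h1 : (φ y).symm ⟨v, Submodule.mem_top⟩ = (φ y).symm ⟨w, Submodule.mem_top⟩ :=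
      Subtype.ext h
    exact congrArg Subtype.val ((φ y).symm.injective h1)
  · ext v
    constructor
    · rintro ⟨w, rfl⟩
      exact ((φ y).symm _).2
    · intro hv
      refine ⟨(φ y ⟨v, hv⟩ : EuclideanSpace 𝕜 (Fin n)), ?_⟩
      exact congrArg Subtype.val ((φ y).symm_apply_apply ⟨v, hv⟩)

theorem IsSubbundle.finrank_eq (hV : IsSubbundle n V) (x : X) : Module.finrank 𝕜 (V x) = n := by
  obtain ⟨U, -, hx, B, -, hB, hr⟩ := hV.exists_local_frame x
  rw [← hr ⟨x, hx⟩, LinearMap.finrank_range_of_inj (hB ⟨x, hx⟩), finrank_euclideanSpace_fin]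

/-- The orthogonal projection onto the range of an injective operator depends continuously on the
operator. -/
theorem continuous_starProjection_range {U H : Type*} [TopologicalSpace U]
    [NormedAddCommGroup H] [InnerProductSpace 𝕜 H] [CompleteSpace H] [FiniteDimensional 𝕜 H]
    {B : U → (EuclideanSpace 𝕜 (Fin n) →L[𝕜] H)} (hB : Continuous B)
    (hinj : ∀ y, Function.Injective (B y)) :
    Continuous fun y => ((B y).range).starProjection := by
  -- `g` is the Gram operator `B* B`, invertible since `B` is injective. The projection is `B (B*
  -- B)⁻¹ B*`, and inversion is continuous at units.
  let g : U → (EuclideanSpace 𝕜 (Fin n) →L[𝕜] EuclideanSpace 𝕜 (Fin n)) :=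
    fun y => (B y).adjoint.comp (B y)
  have hadj : Continuous fun y => (B y).adjoint :=
    ContinuousLinearMap.adjoint.continuous.comp hB
  have hg : Continuous g := hadj.clm_comp hB
  have hunit : ∀ y, IsUnit (g y) := fun y => by
    have hinj' : Function.Injective (g y) := by
      rw [injective_iff_map_eq_zero]
      intro v hv
      have h1 : inner 𝕜 (B y v) (B y v) = 0 := by
        rw [← ContinuousLinearMap.adjoint_inner_left]
        change inner 𝕜 (g y v) v = 0
        rw [hv, inner_zero_left]
      exact (injective_iff_map_eq_zero _).1 (hinj y) v (inner_self_eq_zero.1 h1)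
    exact ⟨ContinuousLinearEquiv.toUnit
      (LinearEquiv.ofInjectiveEndo (g y).toLinearMap hinj').toContinuousLinearEquiv, by ext; rfl⟩
  have hform : ∀ y, ((B y).range).starProjection
      = (B y).comp ((Ring.inverse (g y)).comp (B y).adjoint) := fun y => by
    ext1 u
    refine Submodule.eq_starProjection_of_mem_of_inner_eq_zero ⟨_, rfl⟩ ?_
    rintro _ ⟨k, rfl⟩
    have h1 : g y (Ring.inverse (g y) ((B y).adjoint u)) = (B y).adjoint u := by
      have := congrArg (fun f => f ((B y).adjoint u)) (Ring.mul_inverse_cancel _ (hunit y))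
      exact this
    change inner 𝕜 (u - B y (Ring.inverse (g y) ((B y).adjoint u))) (B y k) = 0
    rw [← ContinuousLinearMap.adjoint_inner_left, map_sub]
    change inner 𝕜 ((B y).adjoint u - g y (Ring.inverse (g y) ((B y).adjoint u))) k = 0
    rw [h1, sub_self, inner_zero_left]
  simp only [hform]
  refine hB.clm_comp (Continuous.clm_comp ?_ hadj)
  refine continuous_iff_continuousAt.2 fun y => ?_
  obtain ⟨a, ha⟩ := hunit y
  exact ContinuousAt.comp (f := g) (by rw [← ha]; exact NormedRing.inverse_continuousAt a)
    hg.continuousAt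

/-- A subbundle of a product bundle is the range of a continuous family of projections. -/
theorem IsSubbundle.exists_projection [FiniteDimensional 𝕜 E] (hV : IsSubbundle n V) :
    ∃ P : X → (E →L[𝕜] E), Continuous P ∧ (∀ x v, P x v ∈ V x) ∧ ∀ x, ∀ v ∈ V x, P x v = v := by
  -- `E` carries no inner product, so orthogonal projections are taken in coordinates and
  -- transported back.
  let e : E ≃L[𝕜] EuclideanSpace 𝕜 (Fin (Module.finrank 𝕜 E)) :=
    ContinuousLinearEquiv.ofFinrankEq (by simp)
  let V' : X → Submodule 𝕜 (EuclideanSpace 𝕜 (Fin (Module.finrank 𝕜 E))) :=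
    fun x => (V x).map (e : E →ₗ[𝕜] _)
  refine ⟨fun x => (e.symm : _ →L[𝕜] E).comp ((V' x).starProjection.comp (e : E →L[𝕜] _)),
    ?_, fun x v => ?_, fun x v hv => ?_⟩
  · refine continuous_const.clm_comp (Continuous.clm_comp ?_ continuous_const)
    refine continuous_iff_continuousAt.2 fun x => ?_
    obtain ⟨U, hU, hx, B, hB, hinj, hr⟩ := hV.exists_local_frame x
    have h1 := continuous_starProjection_range
      (B := fun y => (e : E →L[𝕜] EuclideanSpace 𝕜 (Fin (Module.finrank 𝕜 E))).comp (B y))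
      (continuous_const.clm_comp hB) fun y => e.injective.comp (hinj y)
    have h2 : ∀ y : U, ((e : E →L[𝕜] EuclideanSpace 𝕜 (Fin (Module.finrank 𝕜 E))).comp
        (B y)).range = V' y := fun y => by
      change _ = (V y).map _
      rw [← hr y]
      exact LinearMap.range_comp _ _
    simp only [h2] at h1
    exact (continuousOn_iff_continuous_domRestrict.2 h1).continuousAt (hU.mem_nhds hx)
  · obtain ⟨w, hw, hwe⟩ := Submodule.starProjection_apply_mem (V' x) (e v)
    change e.symm ((V' x).starProjection (e v)) ∈ V x
    rw [← hwe]
    simpa using hw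
  · change e.symm ((V' x).starProjection (e v)) = v
    have hm : e v ∈ V' x := ⟨v, hv, rfl⟩
    rw [Submodule.starProjection_eq_self_iff.2 hm, e.symm_apply_apply]

/-- A continuous family of linear maps that is bijective on the fibres of `V ⊕ Θ(F)` is a bundle
isomorphism. -/
theorem bundleIso_of_bijective [CompactSpace X] [FiniteDimensional 𝕜 E] [FiniteDimensional 𝕜 F]
    (hV : IsSubbundle n V) {T : X → (E × F →L[𝕜] G)} (hT : Continuous T)
    (hinj : ∀ x v w, v ∈ V x → T x (v, w) = 0 → v = 0 ∧ w = 0)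
    (hsurj : ∀ x g, ∃ v ∈ V x, ∃ w, T x (v, w) = g) :
    BundleIso (dirSum V (Theta 𝕜 X F)) (Theta 𝕜 X G) := by
  obtain ⟨P, hP, hPV, hPid⟩ := hV.exists_projection
  let R : X → (E × F →L[𝕜] E × F) := fun x =>
    ((P x).comp (ContinuousLinearMap.fst 𝕜 E F)).prod (ContinuousLinearMap.snd 𝕜 E F)
  have hR : Continuous R := (ContinuousLinearMap.prodₗᵢ 𝕜).continuous.comp
    ((hP.clm_comp continuous_const).prodMk continuous_const)
  -- The fibres vary with `x`, but `(T R, 1 - R)` is an injective operator on the fixed space `E ×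
  -- F`, and it restricts to `(T, 0)` on the fibres.
  obtain ⟨C, hC0, hC⟩ := exists_uniform_lower_bound
    (L := fun x => ((T x).comp (R x)).prod (ContinuousLinearMap.id 𝕜 (E × F) - R x))
    ((ContinuousLinearMap.prodₗᵢ 𝕜).continuous.comp
      ((hT.clm_comp hR).prodMk (continuous_const.sub hR)))
    (fun x => by
      obtain ⟨c, -, hc⟩ := LinearMap.exists_antilipschitzWith
        (((T x).comp (R x)).prod (ContinuousLinearMap.id 𝕜 (E × F) - R x)).toLinearMap (by
          refine LinearMap.ker_eq_bot'.2 ?_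
          rintro ⟨v, w⟩ h
          have h1 : T x (P x v, w) = 0 := congrArg Prod.fst h
          have h2 : v - P x v = 0 := congrArg (fun q => q.2.1) h
          obtain ⟨h3, h4⟩ := hinj x _ _ (hPV x v) h1
          rw [h3, sub_zero] at h2
          rw [h2, h4]
          rfl)
      exact ⟨c, fun u => ZeroHomClass.bound_of_antilipschitz _ hc u⟩)
  have hbound : ∀ x v w, v ∈ V x → ‖(v, w)‖ ≤ C * ‖T x (v, w)‖ := by
    intro x v w hv
    have h1 := hC x (v, w)
    have h2 : R x (v, w) = (v, w) := Prod.ext (hPid x v hv) rfl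
    have h3 : (((T x).comp (R x)).prod (ContinuousLinearMap.id 𝕜 (E × F) - R x)) (v, w)
        = (T x (v, w), 0) := by
      refine Prod.ext ?_ ?_
      · change T x (R x (v, w)) = _
        rw [h2]
      · change (v, w) - R x (v, w) = 0
        rw [h2, sub_self]
    rw [h3] at h1
    simpa [Prod.norm_def] using h1
  let φ : ∀ x, dirSum V (Theta 𝕜 X F) x ≃ₗ[𝕜] Theta 𝕜 X G x := fun x =>
    LinearEquiv.ofBijective (((T x).toLinearMap.domRestrict _).codRestrict _
        fun _ => Submodule.mem_top) (by
      constructor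
      · rw [injective_iff_map_eq_zero]
        rintro ⟨⟨v, w⟩, hvw⟩ h
        obtain ⟨h1, h2⟩ := hinj x v w hvw.1 (congrArg Subtype.val h)
        exact Subtype.ext (Prod.ext h1 h2)
      · rintro ⟨g, _⟩
        obtain ⟨v, hv, w, hvw⟩ := hsurj x g
        exact ⟨⟨(v, w), hv, Submodule.mem_top⟩, Subtype.ext hvw⟩)
  have hφ : ∀ x (q : dirSum V (Theta 𝕜 X F) x), (φ x q : G) = T x q := fun _ _ => rfl
  refine ⟨φ, ?_, ?_⟩
  · change Continuous fun q : Total (dirSum V (Theta 𝕜 X F)) => T q.1.1 q.1.2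
    exact (hT.comp (continuous_fst.comp continuous_subtype_val)).clm_apply
      (continuous_snd.comp continuous_subtype_val)
  · refine continuous_iff_continuousAt.2 fun q₀ => ?_
    set e₀ : E × F := ((φ q₀.1.1).symm ⟨q₀.1.2, q₀.2⟩ : E × F) with he₀
    have he₀V : e₀.1 ∈ V q₀.1.1 := ((φ q₀.1.1).symm ⟨q₀.1.2, q₀.2⟩).2.1
    have hTe₀ : T q₀.1.1 e₀ = q₀.1.2 := by
      rw [he₀, ← hφ, LinearEquiv.apply_symm_apply]
    have hfst : Continuous fun q : Total (Theta 𝕜 X G) => q.1.1 :=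
      continuous_fst.comp continuous_subtype_val
    have hsnd : Continuous fun q : Total (Theta 𝕜 X G) => q.1.2 :=
      continuous_snd.comp continuous_subtype_val
    have hs : Continuous fun q : Total (Theta 𝕜 X G) => R q.1.1 e₀ :=
      (hR.comp hfst).clm_apply continuous_const
    have hRe₀ : R q₀.1.1 e₀ = e₀ := Prod.ext (hPid _ _ he₀V) rfl
    -- The inverse image of `q` is compared with `R q.1.1 e₀`, which lies in the same fibre, where
    -- the lower bound applies, and tends to `e₀` as `q` tends to `q₀`.
    have hest : ∀ q : Total (Theta 𝕜 X G),
        ‖((φ q.1.1).symm ⟨q.1.2, q.2⟩ : E × F) - R q.1.1 e₀‖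
          ≤ C * ‖q.1.2 - T q.1.1 (R q.1.1 e₀)‖ := by
      intro q
      have h1 := hbound q.1.1
        (((φ q.1.1).symm ⟨q.1.2, q.2⟩ : E × F) - R q.1.1 e₀).1
        (((φ q.1.1).symm ⟨q.1.2, q.2⟩ : E × F) - R q.1.1 e₀).2
        ((V q.1.1).sub_mem ((φ q.1.1).symm ⟨q.1.2, q.2⟩).2.1 (hPV _ _))
      rw [Prod.mk.eta, map_sub, ← hφ q.1.1, LinearEquiv.apply_symm_apply] at h1
      exact h1
    have hlim : Filter.Tendsto (fun q : Total (Theta 𝕜 X G) =>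
        C * ‖q.1.2 - T q.1.1 (R q.1.1 e₀)‖) (𝓝 q₀) (𝓝 0) := by
      have hc : Continuous fun q : Total (Theta 𝕜 X G) =>
          C * ‖q.1.2 - T q.1.1 (R q.1.1 e₀)‖ :=
        continuous_const.mul (hsnd.sub ((hT.comp hfst).clm_apply hs)).norm
      have := hc.tendsto q₀
      rwa [hRe₀, hTe₀, sub_self, norm_zero, mul_zero] at this
    have h1 := squeeze_zero_norm hest hlim
    have h2 := h1.add (hs.tendsto q₀)
    simp only [sub_add_cancel, zero_add, hRe₀] at h2
    exact h2

theorem stablyTrivial_of_bijective [CompactSpace X] [FiniteDimensional 𝕜 E]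
    [FiniteDimensional 𝕜 F] [FiniteDimensional 𝕜 G]
    (hV : IsSubbundle n V) {T : X → (E × F →L[𝕜] G)} (hT : Continuous T)
    (hinj : ∀ x v w, v ∈ V x → T x (v, w) = 0 → v = 0 ∧ w = 0)
    (hsurj : ∀ x g, ∃ v ∈ V x, ∃ w, T x (v, w) = g) :
    StablyTrivial V := by
  let eF : F ≃L[𝕜] EuclideanSpace 𝕜 (Fin (Module.finrank 𝕜 F)) :=
    ContinuousLinearEquiv.ofFinrankEq (by simp)
  let eG : G ≃L[𝕜] EuclideanSpace 𝕜 (Fin (Module.finrank 𝕜 G)) :=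
    ContinuousLinearEquiv.ofFinrankEq (by simp)
  let j : E × EuclideanSpace 𝕜 (Fin (Module.finrank 𝕜 F)) →L[𝕜] E × F :=
    (ContinuousLinearMap.id 𝕜 E).prodMap (eF.symm : _ →L[𝕜] F)
  let T' : X → (E × EuclideanSpace 𝕜 (Fin (Module.finrank 𝕜 F)) →L[𝕜]
      EuclideanSpace 𝕜 (Fin (Module.finrank 𝕜 G))) :=
    fun x => (eG : G →L[𝕜] EuclideanSpace 𝕜 (Fin (Module.finrank 𝕜 G))).comp ((T x).comp j)
  have hT' : Continuous T' := continuous_const.clm_comp (hT.clm_comp continuous_const)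
  refine ⟨_, _, bundleIso_of_bijective hV hT' ?_ ?_⟩
  · intro x v w hv h
    have h1 : T x (v, eF.symm w) = 0 := eG.map_eq_zero_iff.1 h
    obtain ⟨h2, h3⟩ := hinj x v _ hv h1
    exact ⟨h2, eF.symm.map_eq_zero_iff.1 h3⟩
  · intro x g
    obtain ⟨v, hv, w, hw⟩ := hsurj x (eG.symm g)
    refine ⟨v, hv, eF w, ?_⟩
    change eG (T x (v, eF.symm (eF w))) = g
    rw [eF.symm_apply_apply, hw, eG.apply_symm_apply]

/-- A stable trivialization is given by a continuous family of linear maps on `E × 𝕜ᵐ`. -/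
theorem IsSubbundle.exists_family_of_bundleIso [FiniteDimensional 𝕜 E] [FiniteDimensional 𝕜 F]
    (hV : IsSubbundle n V) (h : BundleIso (dirSum V (Theta 𝕜 X F)) (Theta 𝕜 X G)) :
    ∃ T : X → (E × F →L[𝕜] G), Continuous T ∧
      (∀ x v w, v ∈ V x → T x (v, w) = 0 → v = 0 ∧ w = 0) ∧
      ∀ x g, ∃ v ∈ V x, ∃ w, T x (v, w) = g := by
  obtain ⟨P, hP, hPV, hPid⟩ := hV.exists_projection
  obtain ⟨φ, hφ, -⟩ := h
  -- Precomposition with the projection extends the fibre maps `φ x` to the whole of `E × F`.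
  let j : ∀ x, E × F →ₗ[𝕜] dirSum V (Theta 𝕜 X F) x := fun x =>
    ((P x).toLinearMap.prodMap LinearMap.id).codRestrict _
      fun q => ⟨hPV x q.1, Submodule.mem_top⟩
  let T : X → (E × F →ₗ[𝕜] G) := fun x =>
    (Theta 𝕜 X G x).subtype ∘ₗ (φ x).toLinearMap ∘ₗ j x
  have hTV : ∀ x v w (hv : v ∈ V x),
      T x (v, w) = φ x ⟨(v, w), hv, Submodule.mem_top⟩ := fun x v w hv => by
    have : j x (v, w) = ⟨(v, w), hv, Submodule.mem_top⟩ :=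
      Subtype.ext (Prod.ext (hPid x v hv) rfl)
    change ((φ x (j x (v, w)) : G)) = _
    rw [this]
  refine ⟨fun x => LinearMap.toContinuousLinearMap (T x), ?_, ?_, ?_⟩
  · refine continuous_clm_apply.2 fun q => ?_
    exact hφ.comp (Continuous.subtype_mk (continuous_id.prodMk
      ((hP.clm_apply continuous_const).prodMk continuous_const))
      fun x => ⟨hPV x q.1, Submodule.mem_top⟩)
  · intro x v w hv h0
    have h1 : ((φ x ⟨(v, w), hv, Submodule.mem_top⟩ : Theta 𝕜 X G x) : G) = 0 := by
      rw [← hTV x v w hv]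
      exact h0
    have h2 := (φ x).map_eq_zero_iff.1 (Subtype.ext h1)
    have h3 := congrArg Subtype.val h2
    exact ⟨congrArg Prod.fst h3, congrArg Prod.snd h3⟩
  · intro x g
    obtain ⟨⟨⟨v, w⟩, hv, hw⟩, hq⟩ := (φ x).surjective ⟨g, Submodule.mem_top⟩
    exact ⟨v, hv, w, (hTV x v w hv).trans (congrArg Subtype.val hq)⟩

/-- Over every point, a family of maps as in `exists_family_of_bundleIso` determines the dimension
of its target. -/
theorem IsSubbundle.finrank_eq_of_bijective [FiniteDimensional 𝕜 E] [FiniteDimensional 𝕜 F]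
    (hV : IsSubbundle n V) {x : X} {T : E × F →L[𝕜] G}
    (hinj : ∀ v w, v ∈ V x → T (v, w) = 0 → v = 0 ∧ w = 0)
    (hsurj : ∀ g, ∃ v ∈ V x, ∃ w, T (v, w) = g) :
    Module.finrank 𝕜 G = n + Module.finrank 𝕜 F := by
  let j : V x × F →ₗ[𝕜] G := T.toLinearMap ∘ₗ (V x).subtype.prodMap LinearMap.id
  have hj : Function.Bijective j := by
    constructor
    · rw [injective_iff_map_eq_zero]
      rintro ⟨v, w⟩ h
      obtain ⟨h1, h2⟩ := hinj v w v.2 h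
      exact Prod.ext (Subtype.ext h1) h2
    · intro g
      obtain ⟨v, hv, w, hw⟩ := hsurj g
      exact ⟨(⟨v, hv⟩, w), hw⟩
  rw [← (LinearEquiv.ofBijective j hj).finrank_eq, Module.finrank_prod, hV.finrank_eq]

end BundleLemmas

/-! ### Functions with prescribed boundary values. -/

section BoundaryLifting

open scoped ENNReal

variable (𝕜 : Type*) [RCLike 𝕜] (n : ℕ) (p : ℝ≥0∞) [Fact (1 ≤ p)]

/-- The difference `(a, b) ↦ b - a` of boundary values. -/
def jumpOp : EuclideanSpace 𝕜 (Fin n) × EuclideanSpace 𝕜 (Fin n) →L[𝕜] EuclideanSpace 𝕜 (Fin n) :=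
  ContinuousLinearMap.snd 𝕜 _ _ - ContinuousLinearMap.fst 𝕜 _ _

/-- The element of `W^{1,p}` with boundary values `z` whose derivative is `f` up to a constant. -/
def liftOp : (EuclideanSpace 𝕜 (Fin n) × EuclideanSpace 𝕜 (Fin n)) × LpI 𝕜 n p →L[𝕜] W1p 𝕜 n p :=
  (sobolevEquiv 𝕜 n p).symm.toContinuousLinearMap.comp
    (((ContinuousLinearMap.fst 𝕜 _ _).comp (ContinuousLinearMap.fst 𝕜 _ _)).prod
      -- The derivative must have mean `z.2 - z.1`, so the mean of `f` is corrected by a constant.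
      (ContinuousLinearMap.snd 𝕜 _ _ + (constOp 𝕜 n p).comp
        ((jumpOp 𝕜 n).comp (ContinuousLinearMap.fst 𝕜 _ _)
          - (meanOp 𝕜 n p).comp (ContinuousLinearMap.snd 𝕜 _ _))))

variable {𝕜 n p}

theorem derivOp_liftOp (z : EuclideanSpace 𝕜 (Fin n) × EuclideanSpace 𝕜 (Fin n))
    (f : LpI 𝕜 n p) : derivOp 𝕜 n p (liftOp 𝕜 n p (z, f))
      = f + constOp 𝕜 n p (jumpOp 𝕜 n z - meanOp 𝕜 n p f) :=
  derivOp_sobolevEquiv_symm _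

theorem boundaryOp_eq (u : W1p 𝕜 n p) : boundaryOp 𝕜 n p u
    = (leftValue 𝕜 n p u, leftValue 𝕜 n p u + meanOp 𝕜 n p (derivOp 𝕜 n p u)) := rfl

@[simp]
theorem jumpOp_boundaryOp (u : W1p 𝕜 n p) :
    jumpOp 𝕜 n (boundaryOp 𝕜 n p u) = meanOp 𝕜 n p (derivOp 𝕜 n p u) :=
  add_sub_cancel_left _ _

theorem boundaryOp_liftOp (z : EuclideanSpace 𝕜 (Fin n) × EuclideanSpace 𝕜 (Fin n))
    (f : LpI 𝕜 n p) : boundaryOp 𝕜 n p (liftOp 𝕜 n p (z, f)) = z := by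
  have h : leftValue 𝕜 n p (liftOp 𝕜 n p (z, f)) = z.1 := leftValue_sobolevEquiv_symm _
  rw [boundaryOp_eq, derivOp_liftOp, h, map_add, meanOp_constOp]
  refine Prod.ext rfl ?_
  change z.1 + (meanOp 𝕜 n p f + (z.2 - z.1 - meanOp 𝕜 n p f)) = z.2
  abel

theorem ext_of_boundaryOp_of_derivOp {u v : W1p 𝕜 n p}
    (hb : boundaryOp 𝕜 n p u = boundaryOp 𝕜 n p v) (hd : derivOp 𝕜 n p u = derivOp 𝕜 n p v) :
    u = v :=
  (sobolevEquiv 𝕜 n p).injective (Prod.ext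
    (show leftValue 𝕜 n p u = leftValue 𝕜 n p v from congrArg Prod.fst hb) hd)

theorem liftOp_boundaryOp_derivOp (u : W1p 𝕜 n p) :
    liftOp 𝕜 n p (boundaryOp 𝕜 n p u, derivOp 𝕜 n p u) = u := by
  refine ext_of_boundaryOp_of_derivOp (boundaryOp_liftOp _ _) ?_
  rw [derivOp_liftOp, jumpOp_boundaryOp, sub_self, map_zero, add_zero]

end BoundaryLifting

/-! ### Boundary problems in abstract form: both constructions as linear algebra. -/

section AbstractBoundaryProblem

variable {𝕜 : Type*} [RCLike 𝕜] {X : Type*} [TopologicalSpace X]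
  {W Y E F : Type*} [NormedAddCommGroup W] [NormedSpace 𝕜 W] [NormedAddCommGroup Y]
  [NormedSpace 𝕜 Y] [NormedAddCommGroup E] [NormedSpace 𝕜 E] [NormedAddCommGroup F]
  [NormedSpace 𝕜 F]

/-- If every `S x` is bounded below on the range of the projection `R x`, then it is so with a
constant independent of `x`. -/
theorem exists_uniform_lower_bound_on_range [CompactSpace X] {R : X → (W →L[𝕜] W)}
    (hR : Continuous R) {S : X → (W →L[𝕜] Y)} (hS : Continuous S)
    (h : ∀ x, ∃ c : ℝ, 0 ≤ c ∧ ∀ u, ‖R x u‖ ≤ c * ‖S x (R x u)‖) :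
    ∃ C : ℝ, 0 < C ∧ ∀ x u, R x u = u → ‖u‖ ≤ C * ‖S x u‖ := by
  obtain ⟨C, hC0, hC⟩ := exists_uniform_lower_bound
    (L := fun x => ((S x).comp (R x)).prod (ContinuousLinearMap.id 𝕜 W - R x))
    ((ContinuousLinearMap.prodₗᵢ 𝕜).continuous.comp
      ((hS.clm_comp hR).prodMk (continuous_const.sub hR)))
    (fun x => by
      obtain ⟨c, hc0, hc⟩ := h x
      refine ⟨c + 1, fun u => ?_⟩
      have h4 : ‖u‖ ≤ ‖R x u‖ + ‖u - R x u‖ := by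
        simpa using norm_add_le (R x u) (u - R x u)
      set N := ‖(((S x).comp (R x)).prod (ContinuousLinearMap.id 𝕜 W - R x)) u‖
      have h5 : ‖S x (R x u)‖ ≤ N := le_max_left _ _
      have h6 : ‖u - R x u‖ ≤ N := le_max_right _ _
      have h7 := hc u
      nlinarith)
  refine ⟨C, hC0, fun x u hu => ?_⟩
  have h1 := hC x u
  have h2 : (((S x).comp (R x)).prod (ContinuousLinearMap.id 𝕜 W - R x)) u = (S x u, 0) := by
    refine Prod.ext ?_ ?_
    · change S x (R x u) = _
      rw [hu]
    · change u - R x u = 0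
      rw [hu, sub_self]
  rw [h2] at h1
  simpa [Prod.norm_def] using h1

/-- The boundary problem for the perturbations of an abstract derivative `D` by operators with
values in a fixed finite dimensional space restricts to a bundle isomorphism. -/
theorem stablyTrivial_of_injective_of_finiteRank [CompactSpace X] [FiniteDimensional 𝕜 E]
    {n : ℕ} {V : X → Submodule 𝕜 (E × E)} (hV : IsSubbundle n V) (hE : Module.finrank 𝕜 E = n)
    {D : W →L[𝕜] Y} {bd : W →L[𝕜] E × E} {c : E →L[𝕜] Y} {mean : Y →L[𝕜] E}
    {lift : (E × E) × Y →L[𝕜] W} (hmc : ∀ a, mean (c a) = a)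
    (hbl : ∀ z f, bd (lift (z, f)) = z)
    (hdl : ∀ z f, D (lift (z, f)) = f + c (z.2 - z.1 - mean f))
    {Q : Y →L[𝕜] Y} [FiniteDimensional 𝕜 Q.range] {K : X → (W →L[𝕜] Y)} (hK : Continuous K)
    (hinj : ∀ x u, bd u ∈ V x → D u + Q (K x u) = 0 → u = 0) :
    StablyTrivial V := by
  -- The constants are included so that `mean` maps `G` onto `E` and the corrections made by `lift`
  -- stay in `G`.
  let G : Submodule 𝕜 Y := Q.range ⊔ c.range
  have hGfin : FiniteDimensional 𝕜 G := Submodule.finiteDimensional_sup _ _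
  have hconst : ∀ a, c a ∈ G := fun a => Submodule.mem_sup_right ⟨a, rfl⟩
  let mG : G →ₗ[𝕜] E := mean.toLinearMap.domRestrict G
  have hmG : Function.Surjective mG := fun a => ⟨⟨_, hconst a⟩, hmc a⟩
  let ι : (E × E) × mG.ker →L[𝕜] W :=
    lift.comp ((ContinuousLinearMap.id 𝕜 _).prodMap (G.subtypeL.comp mG.ker.subtypeL))
  have hιd : ∀ z (m : mG.ker), D (ι (z, m)) = (m : G) + c (z.2 - z.1) := fun z m => by
    have hm : mean (m : G) = 0 := m.2
    change D (lift (z, (m : G))) = _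
    rw [hdl, hm, sub_zero]
  have hιb : ∀ z (m : mG.ker), bd (ι (z, m)) = z := fun z m => hbl _ _
  let T : X → ((E × E) × mG.ker →L[𝕜] G) :=
    fun x => ((D + Q.comp (K x)).comp ι).codRestrict G (by
      rintro ⟨z, m⟩
      change D (ι (z, m)) + Q (K x (ι (z, m))) ∈ G
      rw [hιd]
      exact G.add_mem (G.add_mem (m : G).2 (hconst _)) (Submodule.mem_sup_left ⟨_, rfl⟩))
  have hT : Continuous T := by
    refine continuous_clm_apply.2 fun q => ?_
    refine Continuous.subtype_mk (f := fun x => D (ι q) + Q (K x (ι q))) ?_ _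
    exact continuous_const.add (Q.continuous.comp (hK.clm_apply continuous_const))
  have hTinj : ∀ x v w, v ∈ V x → T x (v, w) = 0 → v = 0 ∧ w = 0 := by
    intro x v w hv h0
    have h1 : ι (v, w) = 0 := by
      refine hinj x _ ?_ (congrArg Subtype.val h0)
      rwa [hιb]
    have h2 := hιb v w
    rw [h1, map_zero] at h2
    have h3 := hιd v w
    rw [h1, map_zero, ← h2, Prod.fst_zero, Prod.snd_zero, sub_zero, map_zero, add_zero] at h3
    exact ⟨h2.symm, Subtype.ext (Subtype.ext h3.symm)⟩
  refine stablyTrivial_of_bijective hV hT hTinj fun x => ?_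
  let j : V x × mG.ker →ₗ[𝕜] G := (T x).toLinearMap ∘ₗ (V x).subtype.prodMap LinearMap.id
  have hj : Function.Injective j := by
    rw [injective_iff_map_eq_zero]
    rintro ⟨v, w⟩ h
    obtain ⟨h1, h2⟩ := hTinj x v w v.2 h
    exact Prod.ext (Subtype.ext h1) h2
  -- Here `dim V x = n = dim E` is decisive: it replaces the dimension lost by passing to the kernel
  -- of the mean.
  have hdim : Module.finrank 𝕜 (V x × mG.ker) = Module.finrank 𝕜 G := by
    rw [Module.finrank_prod, hV.finrank_eq, ← mG.finrank_range_add_finrank_ker,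
      LinearMap.range_eq_top.2 hmG, finrank_top, hE]
  intro g
  obtain ⟨⟨v, w⟩, h⟩ := (LinearMap.injective_iff_surjective_of_finrank_eq_finrank hdim).1 hj g
  exact ⟨v, v.2, w, h⟩

/-- A family of isomorphisms `V ⊕ Θ(F) ≅ Θ(E) ⊕ Θ(F)` yields finite rank perturbations of an
abstract derivative `D` for which the boundary problems are bijective. -/
theorem exists_bijective_perturbation [FiniteDimensional 𝕜 E] [FiniteDimensional 𝕜 F]
    {V : X → Submodule 𝕜 (E × E)}
    {D : W →L[𝕜] Y} {bd : W →L[𝕜] E × E} {c : E →L[𝕜] Y} {mean : Y →L[𝕜] E}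
    (hmc : ∀ a, mean (c a) = a) (hjump : ∀ u, mean (D u) = (bd u).2 - (bd u).1)
    (hext : ∀ u, bd u = 0 → D u = 0 → u = 0)
    (hlift : ∀ z f, ∃ u, bd u = z ∧ D u = f + c (z.2 - z.1 - mean f))
    {ι : F →L[𝕜] Y} {r : Y →L[𝕜] F} (hrι : ∀ k, r (ι k) = k) (hmι : ∀ k, mean (ι k) = 0)
    (hrc : ∀ a, r (c a) = 0)
    {T : X → ((E × E) × F →L[𝕜] E × F)} (hT : Continuous T)
    (hinj : ∀ x v w, v ∈ V x → T x (v, w) = 0 → v = 0 ∧ w = 0)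
    (hsurj : ∀ x g, ∃ v ∈ V x, ∃ w, T x (v, w) = g) :
    ∃ K : X → (W →L[𝕜] Y), Continuous K ∧ (∀ x, IsCompactOperator (K x)) ∧
      ∀ x, (∀ u, bd u ∈ V x → D u + K x u = 0 → u = 0) ∧
        ∀ y, ∃ u, bd u ∈ V x ∧ D u + K x u = y := by
  -- `Y` is the direct sum of the constants, the range of `ι` and `ker mean ∩ ker r`. The
  -- perturbation removes the components `(mean (D u), r (D u))` and inserts `T x (bd u, r (D u))`
  -- in their place, leaving the third component alone.
  let γ : E × F →L[𝕜] Y := c.coprod ι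
  let β : W →L[𝕜] (E × E) × F := bd.prod (r.comp D)
  let δ : W →L[𝕜] E × F := (mean.comp D).prod (r.comp D)
  have : ProperSpace (E × F) := FiniteDimensional.proper 𝕜 (E × F)
  refine ⟨fun x => γ.comp ((T x).comp β - δ),
    continuous_const.clm_comp ((hT.clm_comp continuous_const).sub continuous_const), fun x =>
    (isCompactOperator_of_locallyCompactSpace_rng γ).comp_clm ((T x).comp β - δ), fun x => ?_⟩
  have hA : ∀ u, D u + (γ.comp ((T x).comp β - δ)) u
      = D u + (c ((T x (β u)).1 - mean (D u)) + ι ((T x (β u)).2 - r (D u))) := fun _ => rfl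
  refine ⟨fun u hu h0 => ?_, fun y => ?_⟩
  · rw [hA] at h0
    have h1 : T x (β u) = 0 := by
      refine Prod.ext ?_ ?_
      · have := congrArg mean h0
        rwa [map_add, map_add, hmc, hmι, add_zero, add_sub_cancel, map_zero] at this
      · have := congrArg r h0
        rwa [map_add, map_add, hrc, hrι, zero_add, add_sub_cancel, map_zero] at this
    obtain ⟨h2, h3⟩ := hinj x (bd u) (r (D u)) hu h1
    rw [h1, hjump, h2, h3] at h0
    refine hext u h2 ?_
    simpa using h0
  · obtain ⟨v, hv, w, hvw⟩ := hsurj x (mean y, r y)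
    -- This function has `r`-component `w` and the same mean as `y`; the constant added by the
    -- lifting is invisible to `r`.
    obtain ⟨u, hub, hud⟩ := hlift v (y - ι (r y) + ι w)
    have hur : r (D u) = w := by
      rw [hud, map_add, hrc, map_add, map_sub, hrι, hrι]
      abel
    have hβ : β u = (v, w) := Prod.ext hub hur
    refine ⟨u, by rwa [hub], ?_⟩
    rw [hA, hβ, hvw, hur, hjump, hub, hud]
    simp only [map_add, map_sub, hmι]
    abel

theorem isInvertible_of_bijective [CompleteSpace W] [CompleteSpace Y] {S : Submodule 𝕜 W}
    (hS : IsClosed (S : Set W)) (A : S →L[𝕜] Y) (hinj : ∀ u, A u = 0 → u = 0)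
    (hsurj : Function.Surjective A) : A.IsInvertible := by
  have := hS.completeSpace_coe
  exact ⟨ContinuousLinearEquiv.ofBijective A (LinearMap.ker_eq_bot'.2 hinj)
    (LinearMap.range_eq_top.2 hsurj), by ext; rfl⟩

theorem exists_bound_of_isInvertible {S : Submodule 𝕜 W} {A : S →L[𝕜] Y} (hA : A.IsInvertible) :
    ∃ c : ℝ, 0 ≤ c ∧ ∀ u : S, ‖(u : W)‖ ≤ c * ‖A u‖ := by
  obtain ⟨e, rfl⟩ := hA
  refine ⟨‖(e.symm : Y →L[𝕜] S)‖, norm_nonneg _, fun u => ?_⟩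
  have h := (e.symm : Y →L[𝕜] S).le_opNorm (e u)
  rwa [ContinuousLinearEquiv.coe_coe, e.symm_apply_apply] at h

end AbstractBoundaryProblem

/-! ### Invertible compact perturbations force stable triviality. -/

section InvertibleToStablyTrivial

open scoped ENNReal

variable {𝕜 : Type*} [RCLike 𝕜] {X : Type*} [TopologicalSpace X] [CompactSpace X]
  {n : ℕ} {p : ℝ≥0∞} [Fact (1 ≤ p)]
  {V : X → Submodule 𝕜 (EuclideanSpace 𝕜 (Fin n) × EuclideanSpace 𝕜 (Fin n))}

/-- Invertible compact perturbations `u ↦ u' + K_x u` are uniformly bounded below. -/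
theorem exists_uniform_bound_of_isInvertible (hV : IsSubbundle n V)
    {K : X → (W1p 𝕜 n p →L[𝕜] LpI 𝕜 n p)} (hK : Continuous K)
    (hinv : ∀ x, (bvpOp p (V x) + (K x).comp (bvpDomain p (V x)).subtypeL).IsInvertible) :
    ∃ C : ℝ, 0 < C ∧
      ∀ x u, boundaryOp 𝕜 n p u ∈ V x → ‖u‖ ≤ C * ‖derivOp 𝕜 n p u + K x u‖ := by
  obtain ⟨P, hP, hPV, hPid⟩ := hV.exists_projection
  -- The domain moves with `x`; projecting the boundary values onto `V x` while keeping the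
  -- derivative up to a constant gives a continuous family of projections of the fixed space `W1p`
  -- onto the domains.
  let R : X → (W1p 𝕜 n p →L[𝕜] W1p 𝕜 n p) := fun x =>
    (liftOp 𝕜 n p).comp (((P x).comp (boundaryOp 𝕜 n p)).prod (derivOp 𝕜 n p))
  have hR : Continuous R := continuous_const.clm_comp
    ((ContinuousLinearMap.prodₗᵢ 𝕜).continuous.comp
      ((hP.clm_comp continuous_const).prodMk continuous_const))
  have hRV : ∀ x u, R x u ∈ bvpDomain p (V x) := fun x u => by
    rw [mem_bvpDomain_iff]
    change boundaryOp 𝕜 n p (liftOp 𝕜 n p (P x (boundaryOp 𝕜 n p u), derivOp 𝕜 n p u)) ∈ V x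
    rw [boundaryOp_liftOp]
    exact hPV x _
  have hRid : ∀ x u, boundaryOp 𝕜 n p u ∈ V x → R x u = u := fun x u hu => by
    change liftOp 𝕜 n p (P x (boundaryOp 𝕜 n p u), derivOp 𝕜 n p u) = u
    rw [hPid x _ hu, liftOp_boundaryOp_derivOp]
  obtain ⟨C, hC0, hC⟩ := exists_uniform_lower_bound_on_range hR
    (S := fun x => derivOp 𝕜 n p + K x) (continuous_const.add hK) (fun x => by
      obtain ⟨c, hc0, hc⟩ := exists_bound_of_isInvertible (hinv x)
      exact ⟨c, hc0, fun u => hc ⟨R x u, hRV x u⟩⟩)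
  exact ⟨C, hC0, fun x u hu => hC x u (hRid x u hu)⟩

/-- With approximation error `(2 * C)⁻¹`, an element `u` of the kernel of the finite rank
perturbation satisfies `‖u‖ ≤ ‖u‖ / 2`. Injectivity is all that the dimension count needs. -/
theorem stablyTrivial_of_isInvertible (hV : IsSubbundle n V)
    {K : X → (W1p 𝕜 n p →L[𝕜] LpI 𝕜 n p)} (hK : Continuous K)
    (hc : ∀ x, IsCompactOperator (K x))
    (hinv : ∀ x, (bvpOp p (V x) + (K x).comp (bvpDomain p (V x)).subtypeL).IsInvertible) :
    StablyTrivial V := by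
  obtain ⟨C, hC0, hC⟩ := exists_uniform_bound_of_isInvertible hV hK hinv
  obtain ⟨Q, hQfin, hQ⟩ := exists_finiteRank_comp_approx
    (fun t ε hε => exists_finiteRank_approx_finset t hε) hK hc (ε := (2 * C)⁻¹) (by positivity)
  refine stablyTrivial_of_injective_of_finiteRank hV finrank_euclideanSpace_fin
    (D := derivOp 𝕜 n p) (Q := Q) meanOp_constOp boundaryOp_liftOp derivOp_liftOp hK ?_
  intro x u hu h0
  have h1 := hC x u hu
  have h2 : derivOp 𝕜 n p u + K x u = -(Q (K x u) - K x u) := by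
    rw [eq_neg_of_add_eq_zero_left h0]
    abel
  rw [h2, norm_neg] at h1
  have h3 := h1.trans (mul_le_mul_of_nonneg_left (hQ x u) hC0.le)
  have h4 : C * ((2 * C)⁻¹ * ‖u‖) = ‖u‖ / 2 := by
    have := hC0.ne'
    field_simp
  rw [h4] at h3
  have h5 : ‖u‖ ≤ 0 := by linarith
  exact norm_le_zero_iff.1 h5

end InvertibleToStablyTrivial

/-! ### Stable trivializations yield invertible finite rank perturbations. -/

section StablyTrivialToInvertible

open scoped ENNReal

variable {𝕜 : Type*} [RCLike 𝕜] {n : ℕ} {p : ℝ≥0∞} [Fact (1 ≤ p)]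

theorem eq_zero_of_primOp_eq_zero {f : LpI 𝕜 n p} (hf : primOp 𝕜 n p f = 0) : f = 0 := by
  have hw := isWeakDeriv_primOp f
  rw [hf] at hw
  have key : ∀ᵐ t ∂muI, t ∈ Ioo (0 : ℝ) 1 → f t = 0 := by
    refine isOpen_Ioo.ae_eq_zero_of_integral_contDiff_smul_eq_zero
      ((integrable_coeFn f).locallyIntegrable.locallyIntegrableOn _) fun φ h1 h2 h3 => ?_
    rw [← neg_eq_zero, ← hw φ h1 h2 h3]
    refine integral_eq_zero_of_ae ?_
    filter_upwards [Lp.coeFn_zero (EuclideanSpace 𝕜 (Fin n)) p muI] with t ht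
    rw [ht, Pi.zero_apply, smul_zero]
  refine Lp.ext ?_
  filter_upwards [key, ae_muI_mem_Ioo, Lp.coeFn_zero (EuclideanSpace 𝕜 (Fin n)) p muI]
    with t h1 h2 h3
  rw [h1 h2, h3, Pi.zero_apply]

/-- The continuous representative of a primitive vanishes at `0`. -/
theorem eq_zero_of_constOp_eq_primOp {a : EuclideanSpace 𝕜 (Fin n)} {f : LpI 𝕜 n p}
    (h : primOp 𝕜 n p f = constOp 𝕜 n p a) : a = 0 := by
  have h1 : primFun f =ᵐ[muI] fun _ => a := by
    refine (coeFn_primOp f).symm.trans ?_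
    rw [h]
    exact coeFn_constOp a
  have h2 := Measure.eqOn_Icc_of_ae_eq volume zero_ne_one h1
    (continuous_primFun f).continuousOn continuousOn_const (left_mem_Icc.2 zero_le_one)
  rw [primFun, intervalIntegral.integral_same] at h2
  exact h2.symm

/-- The functions of mean zero form an infinite dimensional space. -/
theorem not_finiteDimensional_ker_meanOp (hn : n ≠ 0) :
    ¬ FiniteDimensional 𝕜 (meanOp 𝕜 n p).ker := by
  intro hfin
  have hY : FiniteDimensional 𝕜 (LpI 𝕜 n p) := by
    refine Module.Finite.of_surjective
      ((meanOp 𝕜 n p).ker.subtype.coprod (constOp 𝕜 n p).toLinearMap) fun f => ?_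
    refine ⟨(⟨f - constOp 𝕜 n p (meanOp 𝕜 n p f), ?_⟩, meanOp 𝕜 n p f), sub_add_cancel _ _⟩
    rw [LinearMap.mem_ker]
    change meanOp 𝕜 n p (f - constOp 𝕜 n p (meanOp 𝕜 n p f)) = 0
    rw [map_sub, meanOp_constOp, sub_self]
  -- On a finite dimensional `L^p` the injective primitive operator would be surjective, yet a
  -- nonzero constant is not a primitive vanishing at `0`.
  have hinj : Function.Injective (primOp 𝕜 n p).toLinearMap :=
    (injective_iff_map_eq_zero _).2 fun f hf => eq_zero_of_primOp_eq_zero hf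
  have : Nontrivial (EuclideanSpace 𝕜 (Fin n)) :=
    Module.nontrivial_of_finrank_pos (R := 𝕜) (by simpa using Nat.pos_of_ne_zero hn)
  obtain ⟨a, ha⟩ := exists_ne (0 : EuclideanSpace 𝕜 (Fin n))
  obtain ⟨f, hf⟩ := LinearMap.injective_iff_surjective.1 hinj (constOp 𝕜 n p a)
  exact ha (eq_zero_of_constOp_eq_primOp hf)

/-- Split embeddings of `𝕜ᵐ` into the functions of mean zero. -/
theorem exists_split_embedding (hn : n ≠ 0) (m : ℕ) :
    ∃ (ι : EuclideanSpace 𝕜 (Fin m) →L[𝕜] LpI 𝕜 n p) (r : LpI 𝕜 n p →L[𝕜] EuclideanSpace 𝕜 (Fin m)),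
      (∀ k, r (ι k) = k) ∧ (∀ k, meanOp 𝕜 n p (ι k) = 0) ∧ ∀ a, r (constOp 𝕜 n p a) = 0 := by
  obtain ⟨f, hf⟩ := Module.Free.exists_linearMap_injective_of_lift_rank_lt
    (R := 𝕜) (M := EuclideanSpace 𝕜 (Fin m)) (N' := (meanOp 𝕜 n p).ker) (by
      refine lt_of_lt_of_le (b := Cardinal.aleph0) ?_ ?_
      · rw [Cardinal.lift_lt_aleph0]
        exact Module.rank_lt_aleph0 𝕜 _
      · rw [Cardinal.aleph0_le_lift, ← not_lt]
        intro h
        exact not_finiteDimensional_ker_meanOp hn (Module.rank_lt_aleph0_iff.1 h))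
  let g : EuclideanSpace 𝕜 (Fin m) →ₗ[𝕜] LpI 𝕜 n p := (meanOp 𝕜 n p).ker.subtype ∘ₗ f
  have hg : Function.Injective g := Subtype.val_injective.comp hf
  obtain ⟨q, hq⟩ := Submodule.ClosedComplemented.of_finiteDimensional (𝕜 := 𝕜) g.range
  let e := (LinearEquiv.ofInjective g hg).toContinuousLinearEquiv
  have hmean : ∀ k, meanOp 𝕜 n p (g k) = 0 := fun k => (f k).2
  -- Subtracting the mean before projecting makes the retraction vanish on constants without
  -- changing it on the range of `g`.
  refine ⟨LinearMap.toContinuousLinearMap g,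
    ((e.symm : g.range →L[𝕜] EuclideanSpace 𝕜 (Fin m)).comp q).comp
      (ContinuousLinearMap.id 𝕜 _ - (constOp 𝕜 n p).comp (meanOp 𝕜 n p)), fun k => ?_, hmean,
    fun a => ?_⟩
  · change e.symm (q (g k - constOp 𝕜 n p (meanOp 𝕜 n p (g k)))) = k
    rw [hmean, map_zero, sub_zero, ContinuousLinearEquiv.symm_apply_eq]
    exact hq ⟨g k, k, rfl⟩
  · change e.symm (q (constOp 𝕜 n p a - constOp 𝕜 n p (meanOp 𝕜 n p (constOp 𝕜 n p a)))) = 0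
    rw [meanOp_constOp, sub_self, map_zero, map_zero]

instance : CompleteSpace (W1p 𝕜 n p) :=
  (sobolevEquiv 𝕜 n p).symm.isUniformEmbedding.isUniformInducing.completeSpace_congr
    (sobolevEquiv 𝕜 n p).symm.surjective |>.1 inferInstance

theorem isClosed_bvpDomain
    (S : Submodule 𝕜 (EuclideanSpace 𝕜 (Fin n) × EuclideanSpace 𝕜 (Fin n))) :
    IsClosed (bvpDomain p S : Set (W1p 𝕜 n p)) := by
  have : (bvpDomain p S : Set (W1p 𝕜 n p)) = boundaryOp 𝕜 n p ⁻¹' S :=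
    Set.ext fun u => mem_bvpDomain_iff
  rw [this]
  exact S.closed_of_finiteDimensional.preimage (boundaryOp 𝕜 n p).continuous

theorem bvpOp_add_isInvertible
    {S : Submodule 𝕜 (EuclideanSpace 𝕜 (Fin n) × EuclideanSpace 𝕜 (Fin n))}
    {K : W1p 𝕜 n p →L[𝕜] LpI 𝕜 n p}
    (hinj : ∀ u, boundaryOp 𝕜 n p u ∈ S → derivOp 𝕜 n p u + K u = 0 → u = 0)
    (hsurj : ∀ y, ∃ u, boundaryOp 𝕜 n p u ∈ S ∧ derivOp 𝕜 n p u + K u = y) :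
    (bvpOp p S + K.comp (bvpDomain p S).subtypeL).IsInvertible := by
  refine isInvertible_of_bijective (W := W1p 𝕜 n p) (Y := LpI 𝕜 n p) (S := bvpDomain p S)
    (isClosed_bvpDomain (p := p) S) (bvpOp p S + K.comp (bvpDomain p S).subtypeL) ?_ ?_
  · exact fun u hu => Subtype.ext (hinj u (mem_bvpDomain_iff.1 u.2) hu)
  · intro y
    obtain ⟨u, hu, huy⟩ := hsurj y
    exact ⟨⟨u, mem_bvpDomain_iff.2 hu⟩, huy⟩

variable {X : Type*} [TopologicalSpace X]
  {V : X → Submodule 𝕜 (EuclideanSpace 𝕜 (Fin n) × EuclideanSpace 𝕜 (Fin n))}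

/-- Counting dimensions in a single fibre gives `N = n + m`, so the target can be written as `𝕜ⁿ ×
𝕜ᵐ`. -/
theorem exists_family_of_stablyTrivial [Nonempty X] (hV : IsSubbundle n V)
    (h : StablyTrivial V) :
    ∃ (m : ℕ) (T : X → ((EuclideanSpace 𝕜 (Fin n) × EuclideanSpace 𝕜 (Fin n)) ×
        EuclideanSpace 𝕜 (Fin m) →L[𝕜] EuclideanSpace 𝕜 (Fin n) × EuclideanSpace 𝕜 (Fin m))),
      Continuous T ∧ (∀ x v w, v ∈ V x → T x (v, w) = 0 → v = 0 ∧ w = 0) ∧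
      ∀ x g, ∃ v ∈ V x, ∃ w, T x (v, w) = g := by
  obtain ⟨x₀⟩ := ‹Nonempty X›
  obtain ⟨m, N, hiso⟩ := h
  obtain ⟨T, hT, hinj, hsurj⟩ := hV.exists_family_of_bundleIso hiso
  have hN := hV.finrank_eq_of_bijective (T := T x₀) (hinj x₀) (hsurj x₀)
  let θ : EuclideanSpace 𝕜 (Fin N) ≃L[𝕜] EuclideanSpace 𝕜 (Fin n) × EuclideanSpace 𝕜 (Fin m) :=
    ContinuousLinearEquiv.ofFinrankEq (by
      rw [hN, Module.finrank_prod, finrank_euclideanSpace_fin, finrank_euclideanSpace_fin])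
  refine ⟨m, fun x => θ.toContinuousLinearMap.comp (T x), continuous_const.clm_comp hT,
    fun x v w hv h0 => hinj x v w hv (θ.map_eq_zero_iff.1 h0), fun x g => ?_⟩
  obtain ⟨v, hv, w, hw⟩ := hsurj x (θ.symm g)
  refine ⟨v, hv, w, ?_⟩
  change θ (T x (v, w)) = g
  rw [hw, θ.apply_symm_apply]

/-- The case `n = 0` stands apart: all function spaces are zero, so `𝕜ᵐ` does not embed in `L^p` for
`m > 0`, but every operator is invertible. -/
theorem bvpOp_isInvertible_of_dim_zero
    (S : Submodule 𝕜 (EuclideanSpace 𝕜 (Fin 0) × EuclideanSpace 𝕜 (Fin 0)))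
    (K : W1p 𝕜 0 p →L[𝕜] LpI 𝕜 0 p) :
    (bvpOp p S + K.comp (bvpDomain p S).subtypeL).IsInvertible := by
  have hY : Subsingleton (LpI 𝕜 0 p) :=
    ⟨fun f g => Lp.ext (.of_forall fun t => Subsingleton.elim _ _)⟩
  refine bvpOp_add_isInvertible (fun u _ _ => ?_) fun y => ⟨0, ?_, Subsingleton.elim _ _⟩
  · exact ext_of_boundaryOp_of_derivOp (Subsingleton.elim _ _) (Subsingleton.elim _ _)
  · rw [map_zero]
    exact S.zero_mem

theorem exists_isInvertible_of_family (hn : n ≠ 0) {m : ℕ}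
    {T : X → ((EuclideanSpace 𝕜 (Fin n) × EuclideanSpace 𝕜 (Fin n)) × EuclideanSpace 𝕜 (Fin m) →L[𝕜]
      EuclideanSpace 𝕜 (Fin n) × EuclideanSpace 𝕜 (Fin m))} (hT : Continuous T)
    (hinj : ∀ x v w, v ∈ V x → T x (v, w) = 0 → v = 0 ∧ w = 0)
    (hsurj : ∀ x g, ∃ v ∈ V x, ∃ w, T x (v, w) = g) :
    ∃ K : X → (W1p 𝕜 n p →L[𝕜] LpI 𝕜 n p), Continuous K ∧ (∀ x, IsCompactOperator (K x)) ∧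
      ∀ x, (bvpOp p (V x) + (K x).comp (bvpDomain p (V x)).subtypeL).IsInvertible := by
  obtain ⟨ι, r, hrι, hmι, hrc⟩ := exists_split_embedding (𝕜 := 𝕜) (p := p) hn m
  obtain ⟨K, hK, hc, hb⟩ := exists_bijective_perturbation (D := derivOp 𝕜 n p)
    (bd := boundaryOp 𝕜 n p) meanOp_constOp (fun u => (jumpOp_boundaryOp u).symm)
    (fun u h1 h2 => ext_of_boundaryOp_of_derivOp (h1.trans (map_zero _).symm)
      (h2.trans (map_zero _).symm))
    (fun z f => ⟨_, boundaryOp_liftOp z f, derivOp_liftOp z f⟩) hrι hmι hrc hT hinj hsurj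
  exact ⟨K, hK, hc, fun x => bvpOp_add_isInvertible (hb x).1 (hb x).2⟩

theorem exists_isInvertible_of_stablyTrivial (hV : IsSubbundle n V) (h : StablyTrivial V) :
    ∃ K : X → (W1p 𝕜 n p →L[𝕜] LpI 𝕜 n p), Continuous K ∧ (∀ x, IsCompactOperator (K x)) ∧
      ∀ x, (bvpOp p (V x) + (K x).comp (bvpDomain p (V x)).subtypeL).IsInvertible := by
  rcases isEmpty_or_nonempty X with hX | hX
  · exact ⟨fun _ => 0, continuous_const, hX.elim, hX.elim⟩
  rcases eq_or_ne n 0 with rfl | hn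
  · exact ⟨fun _ => 0, continuous_const, fun _ => isCompactOperator_zero,
      fun x => bvpOp_isInvertible_of_dim_zero (V x) 0⟩
  · obtain ⟨m, T, hT, hinj, hsurj⟩ := exists_family_of_stablyTrivial hV h
    exact exists_isInvertible_of_family hn hT hinj hsurj

end StablyTrivialToInvertible

end IndexBundle

end

theorem mainTheorem11 {𝕜 : Type*} [RCLike 𝕜] {X : Type*} [TopologicalSpace X] [CompactSpace X]
    (n : ℕ) (p : ENNReal) [Fact (1 ≤ p)]
    (V : X → Submodule 𝕜 (EuclideanSpace 𝕜 (Fin n) × EuclideanSpace 𝕜 (Fin n)))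
    (hV : IndexBundle.IsSubbundle n V) :
    (∃ K : X → (IndexBundle.W1p 𝕜 n p →L[𝕜] IndexBundle.LpI 𝕜 n p),
      Continuous K ∧ (∀ x, IsCompactOperator (K x)) ∧
      ∀ x, (IndexBundle.bvpOp p (V x) +
        (K x).comp (IndexBundle.bvpDomain p (V x)).subtypeL).IsInvertible) ↔
    IndexBundle.StablyTrivial V := by
  constructor
  · rintro ⟨K, hK, hc, hinv⟩
    exact IndexBundle.stablyTrivial_of_isInvertible hV hK hc hinv
  · exact IndexBundle.exists_isInvertible_of_stablyTrivial hV
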